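/- Let $a,b,c$ be positive integers. Consider the hexagon with side lengths $a,b,c,a,b,c$ and all angles $120^\circ$. It is described in the oblique coordinate system with unit vectors $e_1=(\sqrt3/2,-1/2)$ and $e_2=(0,1)$, where it has the successive vertices $$(0,0),\ (b,0),\ (a+b,a),\ (a+b,a+c),\ (a,a+c),\ (0,c),$$ so that the origin is a vertex at which sides of lengths $b$ and $c$ meet and these two sides span the axes. A rhombus tiling of the hexagon is a tiling by rhombi with all sides of length $1$ and angles $60^\circ$ and $120^\circ$, i.e. a partition of the unit triangles of the triangular lattice contained in the hexagon into pairs of triangles sharing an edge. The horizontal rhombus with lowest vertex $(x,y)$ is the unit rhombus with vertices $(x,y)$, $(x+1,y+1)$, $(x,y+1)$, $(x-1,y)$. Let $(x,y)$ be an integer point (in these coordinates) with $0\le x\le a+b-1$ and $1\le y\le a+c-1$. Then the number of rhombus tilings of the hexagon that contain the horizontal rhombus with lowest vertex $(x,y)$ (this number is $0$ if that rhombus is not contained in the hexagon) equals $$\left(\prod_{i=1}^{a}\prod_{j=1}^{b}\prod_{k=1}^{c}\frac{i+j+k-1}{i+j+k-2}\right)\frac{(1)_c}{(b+1)_c} \sum_{n=1}^{a}\sum_{m=1}^{a}\sum_{s=1}^{m}(-1)^{n+s}\binom{c+x-y+n-2}{x-1}\binom{b-x+y+s-1}{b-x+s-1}\frac{(b+1)_{s-1}}{(b+c+1)_{s-1}}\binom{m-1}{s-1}\frac{(c+1)_{n-1}}{(n-1)!}\frac{(b+c+n)_{m-n}}{(m-n)!}.$$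 Here $(z)_k=z(z+1)\cdots(z+k-1)$ for $k\ge1$ and $(z)_0=1$; $\binom{\alpha}{k}=\alpha(\alpha-1)\cdots(\alpha-k+1)/k!$ for every integer $\alpha$ (possibly negative) and every integer $k\ge0$, and $\binom{\alpha}{k}=0$ for $k<0$; and $\frac{(b+c+n)_{m-n}}{(m-n)!}$ is read as $0$ if $m<n$. -/

import Mathlib

/-!
Unit rhombus tilings of the hexagon with side lengths `a, b, c, a, b, c` and all angles `120°`.

Points are written in the oblique coordinate system with unit vectors
`e₁ = (√3/2, -1/2)` and `e₂ = (0, 1)`, whose origin is the vertex of the hexagon at which the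
left vertical side (of length `c`) and the lower left side (of length `b`) meet.  The angle
between `e₁` and `e₂` is `120°`, so `e₁ + e₂ = (√3/2, 1/2)` is a unit vector as well, and the
integer points are the vertices of the triangular lattice with edges `± e₁, ± e₂, ± (e₁ + e₂)`.
-/

namespace RhombusTiling

/-- The point `p` lies in the hexagon whose vertices are, in the oblique coordinates,
`(0,0), (b,0), (a+b,a), (a+b,a+c), (a,a+c), (0,c)`.  Its successive sides have the directions
`e₁, e₁ + e₂, e₂, -e₁, -(e₁ + e₂), -e₂` and the lengths `b, a, c, b, a, c`. -/
abbrev InHexagon (a b c : ℕ) (p : ℤ × ℤ) : Prop :=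
  0 ≤ p.1 ∧ p.1 ≤ a + b ∧ 0 ≤ p.2 ∧ p.2 ≤ a + c ∧ -(b : ℤ) ≤ p.2 - p.1 ∧ p.2 - p.1 ≤ c

/-- The unit triangles of the triangular lattice: the unit parallelogram with
corners `p, p + e₁, p + e₁ + e₂, p + e₂` is cut by its diagonal from `p` to `p + e₁ + e₂` into
the triangle `(p, false)` below and the triangle `(p, true)` above the diagonal. -/
abbrev UnitTriangle : Type := (ℤ × ℤ) × Bool

/-- The three vertices of a unit triangle. -/
def UnitTriangle.vertices : UnitTriangle → Finset (ℤ × ℤ)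
  | ((x, y), false) => {(x, y), (x + 1, y), (x + 1, y + 1)}
  | ((x, y), true) => {(x, y), (x, y + 1), (x + 1, y + 1)}

/-- The unit triangles that make up the hexagon. -/
noncomputable def hexagonTriangles (a b c : ℕ) : Finset UnitTriangle :=
  ((Finset.Icc (0 : ℤ) (a + b) ×ˢ Finset.Icc (0 : ℤ) (a + c)) ×ˢ Finset.univ).filter
    fun t => ∀ p ∈ UnitTriangle.vertices t, InHexagon a b c p

/-- The unit rhombi (with angles `60°` and `120°`) contained in the hexagon.  A rhombus is
recorded as the set of the two unit triangles it consists of; these share an edge, that is,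
they have exactly two vertices in common. -/
noncomputable def hexagonRhombi (a b c : ℕ) : Finset (Finset UnitTriangle) :=
  ((hexagonTriangles a b c).powersetCard 2).filter fun r =>
    ∀ t ∈ r, ∀ u ∈ r, t ≠ u →
      (UnitTriangle.vertices t ∩ UnitTriangle.vertices u).card = 2

/-- The rhombus tilings of the hexagon: the sets of rhombi contained in the hexagon that cover
every unit triangle of the hexagon exactly once. -/
noncomputable def tilings (a b c : ℕ) : Finset (Finset (Finset UnitTriangle)) :=
  (hexagonRhombi a b c).powerset.filter fun T =>
    ∀ t ∈ hexagonTriangles a b c, (T.filter fun r => t ∈ r).card = 1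

/-- The horizontal rhombus (the one whose longer diagonal is horizontal) with lowest vertex
`(x, y)`.  Its left, lowest, right and uppermost vertices are
`(x - 1, y), (x, y), (x + 1, y + 1), (x, y + 1)`; its shorter, vertical diagonal cuts it into
the triangles with vertices `(x - 1, y), (x, y), (x, y + 1)` and
`(x, y), (x, y + 1), (x + 1, y + 1)`. -/
def horizontalRhombus (x y : ℤ) : Finset UnitTriangle :=
  {((x - 1, y), false), ((x, y), true)}

/-- The number of rhombus tilings of the hexagon that contain the horizontal rhombus with
lowest vertex `(x, y)`. -/
noncomputable def numTilingsContaining (a b c : ℕ) (x y : ℤ) : ℕ :=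
  ((tilings a b c).filter fun T => horizontalRhombus x y ∈ T).card

/-- The binomial coefficient `α (α - 1) ⋯ (α - k + 1) / k!` for integers `α` and `k ≥ 0`, where
`α` may be negative; it is zero for `k < 0`. -/
def binom (α k : ℤ) : ℤ :=
  if k < 0 then 0 else Ring.choose α k.toNat

/-- The Pochhammer symbol `(z)_k = z (z + 1) ⋯ (z + k - 1)`, with `(z)_0 = 1`. -/
noncomputable def poch (z : ℚ) (k : ℕ) : ℚ :=
  (ascPochhammer ℚ k).eval z

/-- The quotient `(z)_k / k!` for an integer `k`; it is zero for `k < 0`, in accordance with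
`1 / k! = 0` for negative integers `k`. -/
noncomputable def pochDivFactorial (z : ℚ) (k : ℤ) : ℚ :=
  if k < 0 then 0 else poch z k.toNat / (k.toNat.factorial : ℚ)

end RhombusTiling

namespace RhombusTiling

/-! Follow the edges of direction `e₁ + e₂` through a tiling. The rhombi having such an edge as a
side, namely the horizontal and the vertical ones, link up into `a` nonintersecting lattice paths
with `b + c` steps joining the two sides of length `a`. A horizontal rhombus is a step to the left,
a vertical one keeps the position, and the axis rhombi are forced by the gaps
(`card_tilings_filter`). A determinant then counts these families (`card_isFamily_eq_det`), giving
`det M` for all tilings with `M = pathMatrix a b c`.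

Avoiding one horizontal rhombus means forbidding one step. This subtracts from `M` the rank-one
matrix `u vᵀ`, where `u` counts paths into the step and `v` paths out of it (`pathCount_forbid`). By
the matrix determinant lemma the tilings containing the rhombus number `det M * (v ⬝ᵥ M⁻¹ u)`
(`numTilingsContaining_eq`).

Both factors are explicit. With the Pascal matrix `P` and lower triangular `L`, `R`, one has `L (P M
Pᵀ) Rᵀ = (b+c)!/(b! c!) • 1` (`leftFactor_mul_mul_rightFactor`). Determinants give the box product;
inversion gives `v ⬝ᵥ M⁻¹ u` as a multiple of `(R P v) ⬝ᵥ (L P u)`, which is the triple sum once `P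
u` and `P v` are evaluated by Vandermonde.

If the slice of the rhombus lies outside the range of times, the count is `0` and the path
interpretation is lost. There `v ⬝ᵥ M⁻¹ u = 0` is shown algebraically. -/

/-! ### Binomial coefficients and Vandermonde sums. -/

theorem binom_of_neg (α : ℤ) {k : ℤ} (hk : k < 0) : binom α k = 0 := if_pos hk

theorem binom_natCast (n k : ℕ) : binom n k = n.choose k := by
  simp [binom, Ring.choose_natCast]

theorem binom_of_lt {n : ℕ} {k : ℤ} (hk : (n : ℤ) < k) : binom n k = 0 := by
  lift k to ℕ using by omega
  rw [binom_natCast, Nat.choose_eq_zero_of_lt (by omega), Nat.cast_zero]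

theorem binom_zero_right (α : ℤ) : binom α 0 = 1 := by simp [binom]

theorem binom_zero_left (k : ℤ) : binom 0 k = if k = 0 then 1 else 0 := by
  split_ifs with h
  · rw [h, binom_zero_right]
  · rcases lt_or_gt_of_ne h with h | h
    · exact binom_of_neg _ h
    · exact binom_of_lt (n := 0) h

theorem binom_succ (α k : ℤ) : binom (α + 1) k = binom α (k - 1) + binom α k := by
  rcases lt_trichotomy k 0 with h | rfl | h
  · rw [binom_of_neg _ h, binom_of_neg _ h, binom_of_neg _ (by omega), add_zero]
  · rw [binom_zero_right, binom_zero_right, binom_of_neg _ (by omega), zero_add]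
  · obtain ⟨m, rfl⟩ : ∃ m : ℕ, k = m + 1 := ⟨(k - 1).toNat, by omega⟩
    have h1 : ((m : ℤ) + 1).toNat = m + 1 := by omega
    simp [binom, h1, Ring.choose_succ_succ, show ¬ ((m : ℤ) + 1 < 0) by omega]

theorem sum_range_binom_zero_mul {a x₀ : ℕ} (h : x₀ < a) (F : ℕ → ℤ) :
    ∑ j ∈ Finset.range a, binom (0 : ℕ) (j - x₀) * F j = F x₀ := by
  rw [Finset.sum_eq_single_of_mem x₀ (Finset.mem_range.2 h)]
  · simp [binom_zero_right]
  · intro j _ hj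
    rw [Nat.cast_zero, binom_zero_left, if_neg (by omega), zero_mul]

/-- Pascal's rule as a recursion in `n` that shifts `x₀`. It drives the three summations below, for
which `x₀ + n < a` keeps the support of the weights inside the range. -/
theorem sum_range_binom_succ_mul (a n x₀ : ℕ) (F : ℕ → ℤ) :
    ∑ j ∈ Finset.range a, binom ((n + 1 : ℕ) : ℤ) (j - x₀) * F j =
      ∑ j ∈ Finset.range a, binom n (j - x₀) * F j +
        ∑ j ∈ Finset.range a, binom n (j - (x₀ + 1 : ℕ)) * F j := by
  rw [← Finset.sum_add_distrib]
  refine Finset.sum_congr rfl fun j _ => ?_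
  rw [Nat.cast_succ, binom_succ, Nat.cast_succ, sub_sub]
  ring

theorem sum_range_binom_mul_binom_sub {a n x₀ : ℕ} (h : x₀ + n < a) (α β : ℤ) :
    ∑ j ∈ Finset.range a, binom n (j - x₀) * binom α (β - j) = binom (α + n) (β - x₀) := by
  induction n generalizing x₀ with
  | zero => rw [sum_range_binom_zero_mul (by omega) fun j => binom α (β - j)]; simp
  | succ n ih =>
    rw [sum_range_binom_succ_mul a n x₀ fun j => binom α (β - j), ih (by omega), ih (by omega),
      Nat.cast_succ n, ← add_assoc, binom_succ, Nat.cast_succ, sub_sub, add_comm]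

theorem sum_range_binom_mul_binom_add {a n x₀ : ℕ} (h : x₀ + n < a) (α β : ℤ) :
    ∑ j ∈ Finset.range a, binom n (j - x₀) * binom α (β + j) =
      binom (α + n) (β + x₀ + n) := by
  induction n generalizing x₀ with
  | zero => rw [sum_range_binom_zero_mul (by omega) fun j => binom α (β + j)]; simp
  | succ n ih =>
    rw [sum_range_binom_succ_mul a n x₀ fun j => binom α (β + j), ih (by omega), ih (by omega),
      Nat.cast_succ n, ← add_assoc, binom_succ, Nat.cast_succ]
    ring_nf

/-- The sum is, up to sign, an `n`-th finite difference of `binom · k`, and each difference lowers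
`k` by one. -/
theorem sum_range_alternating_binom_mul_binom {a n x₀ : ℕ} (h : x₀ + n < a) (α k : ℤ) :
    ∑ j ∈ Finset.range a, binom n (j - x₀) * ((-1) ^ j * binom (α + j) k) =
      (-1) ^ (n + x₀) * binom (α + x₀) (k - n) := by
  induction n generalizing x₀ with
  | zero =>
    rw [sum_range_binom_zero_mul (by omega) fun j => (-1) ^ j * binom (α + j) k]; simp
  | succ n ih =>
    rw [sum_range_binom_succ_mul a n x₀ fun j => (-1) ^ j * binom (α + j) k, ih (by omega),
      ih (by omega), Nat.cast_succ, Nat.cast_succ, ← add_assoc α, binom_succ (α + x₀),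
      ← sub_sub k]
    ring

/-! ### Determinant and inverse of the path matrix. -/

theorem poch_natCast_succ (m k : ℕ) :
    poch ((m : ℚ) + 1) k = ((m + k).factorial : ℚ) / m.factorial := by
  rw [poch, show (m : ℚ) + 1 = ((m + 1 : ℕ) : ℚ) by push_cast; ring, ascPochhammer_nat_eq_natCast_ascFactorial,
    eq_div_iff (by positivity), ← Nat.factorial_mul_ascFactorial m k]
  push_cast; ring

/-- The convention `1 / k! = 0` for `k < 0` matches the vanishing of `choose` when `p < n`; this is
what makes `rightFactor` lower triangular. -/
theorem pochDivFactorial_natCast_succ (m p n : ℕ) :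
    pochDivFactorial ((m : ℚ) + n + 1) ((p : ℤ) - n) = ((m + p).choose (m + n) : ℚ) := by
  rw [pochDivFactorial]
  split_ifs with h
  · rw [Nat.choose_eq_zero_of_lt (by omega), Nat.cast_zero]
  · obtain ⟨d, rfl⟩ := Nat.exists_eq_add_of_le (show n ≤ p by omega)
    rw [show ((n + d : ℕ) : ℤ) - n = d by push_cast; ring, Int.toNat_natCast,
      show (m : ℚ) + n + 1 = ((m + n : ℕ) : ℚ) + 1 by push_cast; ring, poch_natCast_succ,
      ← add_assoc, Nat.cast_add_choose]
    field_simp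

open Matrix

/-- The numbers of lattice paths with `b + c` steps between the two sides of length `a`. -/
noncomputable def pathMatrix (a b c : ℕ) : Matrix (Fin a) (Fin a) ℚ :=
  of fun i j => (binom ((b : ℤ) + c) ((b : ℤ) + (i : ℕ) - (j : ℕ)) : ℚ)

/-- The lower triangular Pascal matrix. -/
noncomputable def pascalMatrix (a : ℕ) : Matrix (Fin a) (Fin a) ℚ :=
  of fun s i => (binom (s : ℕ) (i : ℕ) : ℚ)

/-- The left factor that triangularizes the path matrix. -/
noncomputable def leftFactor (a b c : ℕ) : Matrix (Fin a) (Fin a) ℚ :=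
  of fun m s => (-1 : ℚ) ^ (s : ℕ) * (poch ((b : ℚ) + 1) s / poch ((b : ℚ) + c + 1) s) *
    ((m : ℕ).choose s : ℚ)

/-- The right factor that triangularizes the path matrix. -/
noncomputable def rightFactor (a b c : ℕ) : Matrix (Fin a) (Fin a) ℚ :=
  of fun m n => (-1 : ℚ) ^ (n : ℕ) * (poch ((c : ℚ) + 1) n / ((n : ℕ).factorial : ℚ)) *
    pochDivFactorial ((b : ℚ) + c + (n : ℕ) + 1) ((m : ℕ) - (n : ℕ) : ℤ)

theorem leftFactor_apply (a b c : ℕ) (m s : Fin a) :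
    leftFactor a b c m s = (-1 : ℚ) ^ (s : ℕ) *
      (((b + s).factorial : ℚ) / b.factorial / ((b + c + s).factorial / (b + c).factorial)) *
      ((m : ℕ).choose s : ℚ) := by
  rw [leftFactor, of_apply, poch_natCast_succ, ← Nat.cast_add b c, poch_natCast_succ]

theorem rightFactor_apply (a b c : ℕ) (m n : Fin a) :
    rightFactor a b c m n = (-1 : ℚ) ^ (n : ℕ) *
      (((c + n).factorial : ℚ) / c.factorial / (n : ℕ).factorial) *
      ((b + c + m).choose (b + c + n) : ℚ) := by
  rw [rightFactor, of_apply, poch_natCast_succ, ← Nat.cast_add b c, pochDivFactorial_natCast_succ]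

theorem pascal_mul_path_apply (a b c : ℕ) (s j : Fin a) :
    (pascalMatrix a * pathMatrix a b c) s j =
      (binom ((b : ℤ) + c + (s : ℕ)) ((b : ℤ) - (j : ℕ) + (s : ℕ)) : ℚ) := by
  have h := sum_range_binom_mul_binom_add (a := a) (n := s) (x₀ := 0) (by omega)
    ((b : ℤ) + c) ((b : ℤ) - (j : ℕ))
  rw [Finset.sum_range] at h
  simp only [Nat.cast_zero, sub_zero, add_zero] at h
  rw [← h, mul_apply]
  push_cast
  refine Finset.sum_congr rfl fun i _ => ?_
  rw [pascalMatrix, pathMatrix, of_apply, of_apply, add_sub_right_comm]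

/-- Two Vandermonde sums, one on each side, turn the Toeplitz matrix into one whose entries are
single factorial quotients in `s` and `n`. -/
theorem pascal_mul_path_mul_transpose_apply (a b c : ℕ) (s n : Fin a) :
    (pascalMatrix a * pathMatrix a b c * (pascalMatrix a)ᵀ) s n =
      ((b + c + s + n).choose (b + s) : ℚ) := by
  have h := sum_range_binom_mul_binom_sub (a := a) (n := n) (x₀ := 0) (by omega)
    ((b : ℤ) + c + (s : ℕ)) ((b : ℤ) + (s : ℕ))
  rw [Finset.sum_range] at h
  simp only [Nat.cast_zero, sub_zero] at h
  have h' := binom_natCast (b + c + s + n) (b + s)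
  push_cast at h'
  rw [h'] at h
  have h2 := congrArg (Int.cast : ℤ → ℚ) h
  rw [Int.cast_natCast] at h2
  rw [← h2, mul_apply]
  push_cast
  refine Finset.sum_congr rfl fun i _ => ?_
  rw [pascal_mul_path_apply, transpose_apply, pascalMatrix, of_apply, sub_add_eq_add_sub, mul_comm]

theorem binom_add_sub (d n m : ℕ) :
    binom ((d : ℤ) + n) ((n : ℤ) - m) = ((d + n).choose (d + m) : ℤ) := by
  rcases lt_or_ge n m with h | h
  · rw [binom_of_neg _ (by omega), Nat.choose_eq_zero_of_lt (by omega), Nat.cast_zero]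
  · rw [← Nat.cast_add, ← Nat.cast_sub h, binom_natCast,
      ← Nat.choose_symm_of_eq_add (show d + n = (d + m) + (n - m) by omega)]

/-- The Pochhammer quotient in `leftFactor` cancels `(b + s)!` and `(b + c + s)!`. What remains of
the sum over `s` is an `m`-th difference of `(b + c + n + s).choose n`, so the product is upper
triangular. -/
theorem leftFactor_mul_apply (a b c : ℕ) (m n : Fin a) :
    (leftFactor a b c * (pascalMatrix a * pathMatrix a b c * (pascalMatrix a)ᵀ)) m n =
      (-1 : ℚ) ^ (m : ℕ) * ((b + c).factorial / b.factorial) *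
        ((n : ℕ).factorial / (c + n).factorial) *
        ((b + c + n).choose (b + c + m) : ℚ) := by
  have h := sum_range_alternating_binom_mul_binom (a := a) (n := m) (x₀ := 0) (by omega)
    (((b + c + n : ℕ) : ℤ)) (n : ℕ)
  rw [Finset.sum_range] at h
  simp only [Nat.cast_zero, sub_zero, add_zero] at h
  rw [Nat.cast_add (b + c) (n : ℕ), binom_add_sub (b + c) n m, ← Nat.cast_add] at h
  simp only [← Nat.cast_add, binom_natCast] at h
  have h2 := congrArg (Int.cast : ℤ → ℚ) h
  push_cast at h2
  have h3 : (-1 : ℚ) ^ (m : ℕ) * ((b + c).factorial / b.factorial) *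
      ((n : ℕ).factorial / (c + n).factorial) * ((b + c + n).choose (b + c + m) : ℚ) =
      ((-1 : ℚ) ^ (m : ℕ) * ((b + c + n).choose (b + c + m) : ℚ)) *
        (((b + c).factorial / b.factorial) * ((n : ℕ).factorial / (c + n).factorial)) := by ring
  rw [h3, ← h2, mul_apply, Finset.sum_mul]
  refine Finset.sum_congr rfl fun s _ => ?_
  rw [leftFactor_apply, pascal_mul_path_mul_transpose_apply,
    show b + c + (s : ℕ) + n = (b + s) + (c + n) by omega, Nat.cast_add_choose,
    show b + c + (n : ℕ) + s = n + (b + c + s) by omega, Nat.cast_add_choose,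
    show (b + s) + (c + n) = (n : ℕ) + (b + c + s) by omega]
  field_simp

/-- Binomial inversion: the product of the two binomials is `(d + p).choose (d + m) * (p - m).choose
(n - m)`, and the alternating row sum of order `p - m` vanishes unless `p = m`. -/
theorem sum_alternating_choose_mul_choose {a m p : ℕ} (hp : p < a) (d : ℕ) :
    ∑ n ∈ Finset.range a, (-1 : ℚ) ^ n * (d + p).choose (d + n) * (d + n).choose (d + m) =
      if m = p then (-1) ^ m else 0 := by
  have key : ∀ n, (d + p).choose (d + n) * (d + n).choose (d + m) =
      (d + p).choose (d + m) * if m ≤ n then (p - m).choose (n - m) else 0 := by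
    intro n
    split_ifs with h
    · rw [Nat.choose_mul (Nat.add_le_add_left h d)]
      congr 2 <;> omega
    · rw [Nat.choose_eq_zero_of_lt (show d + n < d + m by omega), mul_zero, mul_zero]
  have key2 : ∀ n, (-1 : ℚ) ^ n * (d + p).choose (d + n) * (d + n).choose (d + m) =
      (-1 : ℚ) ^ n * ((d + p).choose (d + m) *
        if m ≤ n then ((p - m).choose (n - m) : ℚ) else 0) := by
    intro n
    rw [mul_assoc, ← Nat.cast_mul, key]
    push_cast; rfl
  simp only [key2]
  rcases lt_or_ge p m with h | h
  · rw [Nat.choose_eq_zero_of_lt (show d + p < d + m by omega), if_neg (by omega)]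
    simp
  -- With `α = k = 0` the second binomial is constantly `1`, leaving the plain alternating sum.
  · have h1 := sum_range_alternating_binom_mul_binom (a := a) (n := p - m) (x₀ := m) (by omega) 0 0
    have h2 := congrArg (Int.cast : ℤ → ℚ) h1
    push_cast at h2
    have h3 : ∀ n : ℕ, (-1 : ℚ) ^ n * ((d + p).choose (d + m) *
        if m ≤ n then ((p - m).choose (n - m) : ℚ) else 0) =
        (d + p).choose (d + m) * ((binom ((p - m : ℕ) : ℤ) ((n : ℤ) - m) : ℚ) *
          ((-1) ^ n * (binom (0 + n) 0 : ℚ))) := by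
      intro n
      rw [binom_zero_right]
      split_ifs with hn
      · rw [← Nat.cast_sub hn, binom_natCast]; push_cast; ring
      · rw [binom_of_neg _ (by omega)]; simp
    simp only [h3]
    rw [← Finset.mul_sum, h2]
    split_ifs with hmp
    · subst hmp; simp [binom_zero_right]
    · rw [binom_of_neg _ (by omega)]; simp

theorem leftFactor_mul_mul_rightFactor (a b c : ℕ) :
    leftFactor a b c * (pascalMatrix a * pathMatrix a b c * (pascalMatrix a)ᵀ) *
        (rightFactor a b c)ᵀ = (((b + c).factorial : ℚ) / (b.factorial * c.factorial)) • 1 := by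
  ext m p
  rw [mul_apply, Matrix.smul_apply, one_apply]
  have h := sum_alternating_choose_mul_choose (m := m) p.2 (b + c)
  rw [Finset.sum_range] at h
  have : ∀ n : Fin a, (leftFactor a b c * (pascalMatrix a * pathMatrix a b c *
      (pascalMatrix a)ᵀ)) m n * (rightFactor a b c)ᵀ n p =
      ((-1 : ℚ) ^ (m : ℕ) * ((b + c).factorial / (b.factorial * c.factorial))) *
      ((-1 : ℚ) ^ (n : ℕ) * (b + c + p).choose (b + c + n) *
        (b + c + n).choose (b + c + m)) := by
    intro n
    rw [leftFactor_mul_apply, transpose_apply, rightFactor_apply]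
    field_simp
  simp only [this]
  rw [← Finset.mul_sum, h]
  by_cases hmp : m = p
  · subst hmp
    rw [if_pos rfl, if_pos rfl, mul_right_comm, ← mul_pow]
    simp
  · rw [if_neg hmp, if_neg fun h => hmp (Fin.ext h)]
    simp

theorem det_pascalMatrix (a : ℕ) : (pascalMatrix a).det = 1 := by
  rw [det_of_isLowerTriangular]
  · exact Finset.prod_eq_one fun i _ => by simp [pascalMatrix, binom_natCast]
  · intro i j hij
    have hij : (i : ℕ) < j := hij
    rw [pascalMatrix, of_apply, binom_natCast, Nat.choose_eq_zero_of_lt hij]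
    simp

theorem det_leftFactor (a b c : ℕ) :
    (leftFactor a b c).det = ∏ s : Fin a, (-1 : ℚ) ^ (s : ℕ) *
      (((b + s).factorial : ℚ) / b.factorial / ((b + c + s).factorial / (b + c).factorial)) := by
  rw [det_of_isLowerTriangular]
  · exact Finset.prod_congr rfl fun i _ => by simp [leftFactor_apply]
  · intro i j hij
    have hij : (i : ℕ) < j := hij
    rw [leftFactor_apply, Nat.choose_eq_zero_of_lt hij, Nat.cast_zero, mul_zero]

theorem det_rightFactor (a b c : ℕ) :
    (rightFactor a b c).det = ∏ n : Fin a, (-1 : ℚ) ^ (n : ℕ) *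
      (((c + n).factorial : ℚ) / c.factorial / (n : ℕ).factorial) := by
  rw [det_of_isLowerTriangular]
  · exact Finset.prod_congr rfl fun i _ => by simp [rightFactor_apply]
  · intro i j hij
    have hij : (i : ℕ) < j := hij
    rw [rightFactor_apply, Nat.choose_eq_zero_of_lt (by omega), Nat.cast_zero, mul_zero]

/-- Take determinants in the triangular factorization; the signs of the two factors cancel. -/
theorem det_pathMatrix (a b c : ℕ) :
    (pathMatrix a b c).det = ∏ s : Fin a,
      (((b + c + s).factorial * (s : ℕ).factorial : ℚ) /
        ((b + s).factorial * (c + s).factorial)) := by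
  have h := congrArg det (leftFactor_mul_mul_rightFactor a b c)
  simp only [det_mul, det_transpose, det_pascalMatrix, one_mul, mul_one, det_smul, det_one,
    Fintype.card_fin, det_leftFactor, det_rightFactor] at h
  have h0 : (∏ s : Fin a, (-1 : ℚ) ^ (s : ℕ) *
      (((b + s).factorial : ℚ) / b.factorial / ((b + c + s).factorial / (b + c).factorial))) *
      (∏ n : Fin a, (-1 : ℚ) ^ (n : ℕ) *
      (((c + n).factorial : ℚ) / c.factorial / (n : ℕ).factorial)) ≠ 0 := by
    refine mul_ne_zero (Finset.prod_ne_zero_iff.2 fun _ _ => by positivity)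
      (Finset.prod_ne_zero_iff.2 fun _ _ => by positivity)
  rw [mul_right_comm] at h
  refine mul_left_cancel₀ h0 (h.trans ?_)
  rw [← Finset.prod_mul_distrib, ← Finset.prod_mul_distrib]
  rw [← Fin.prod_const]
  refine Finset.prod_congr rfl fun s _ => ?_
  have : (-1 : ℚ) ^ (s : ℕ) * (-1) ^ (s : ℕ) = 1 := by rw [← mul_pow]; simp
  rw [mul_mul_mul_comm ((-1 : ℚ) ^ (s : ℕ)), this]
  field_simp

theorem isUnit_det_pathMatrix (a b c : ℕ) : IsUnit (pathMatrix a b c).det := by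
  rw [det_pathMatrix]
  exact (Finset.prod_ne_zero_iff.2 fun _ _ => by positivity).isUnit

theorem inv_pathMatrix (a b c : ℕ) :
    (pathMatrix a b c)⁻¹ = ((b.factorial * c.factorial : ℚ) / (b + c).factorial) •
      ((pascalMatrix a)ᵀ * (rightFactor a b c)ᵀ * (leftFactor a b c * pascalMatrix a)) := by
  have h := leftFactor_mul_mul_rightFactor a b c
  refine inv_eq_right_inv ?_
  have h1 : (leftFactor a b c * pascalMatrix a) * (pathMatrix a b c *
      (((b.factorial * c.factorial : ℚ) / (b + c).factorial) •
      ((pascalMatrix a)ᵀ * (rightFactor a b c)ᵀ))) = 1 := by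
    simp only [Matrix.mul_assoc, Matrix.mul_smul] at h ⊢
    rw [h, smul_smul]
    convert one_smul ℚ _
    field_simp
  -- A one-sided inverse of a square matrix is two-sided, so `leftFactor * pascalMatrix` may be
  -- moved from the left end of the product to the right end.
  have h2 := mul_eq_one_comm.1 h1
  rw [← h2]
  simp only [Matrix.mul_assoc, Matrix.mul_smul, Matrix.smul_mul]

theorem dotProduct_inv_pathMatrix_mulVec (a b c : ℕ) (u v : Fin a → ℚ) :
    v ⬝ᵥ ((pathMatrix a b c)⁻¹ *ᵥ u) =
      ((b.factorial * c.factorial : ℚ) / (b + c).factorial) *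
      ((rightFactor a b c *ᵥ (pascalMatrix a *ᵥ v)) ⬝ᵥ
        (leftFactor a b c *ᵥ (pascalMatrix a *ᵥ u))) := by
  rw [inv_pathMatrix, smul_mulVec, dotProduct_smul, smul_eq_mul, ← mulVec_mulVec, ← mulVec_mulVec,
    ← mulVec_mulVec, dotProduct_mulVec, vecMul_transpose, dotProduct_mulVec, vecMul_transpose]

/-- The product over `k` telescopes and the one over `j` collects into factorials; index `i` then
gives one factor of `det_pathMatrix`. -/
theorem prod_box_eq_det_pathMatrix (a b c : ℕ) :
    (∏ i ∈ Finset.Icc 1 a, ∏ j ∈ Finset.Icc 1 b, ∏ k ∈ Finset.Icc 1 c,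
      ((i : ℚ) + (j : ℚ) + (k : ℚ) - 1) / ((i : ℚ) + (j : ℚ) + (k : ℚ) - 2)) =
      (pathMatrix a b c).det := by
  have icc : ∀ (f : ℕ → ℚ) (n : ℕ), ∏ k ∈ Finset.Icc 1 n, f k = ∏ k ∈ Finset.range n, f (k + 1) := by
    intro f n
    rw [Finset.range_eq_Ico, Finset.prod_Ico_add' f 0 n 1]
    rfl
  have inner : ∀ i j : ℕ, ∏ k ∈ Finset.range c,
      (((i + 1 : ℕ) : ℚ) + ((j + 1 : ℕ) : ℚ) + ((k + 1 : ℕ) : ℚ) - 1) /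
        (((i + 1 : ℕ) : ℚ) + ((j + 1 : ℕ) : ℚ) + ((k + 1 : ℕ) : ℚ) - 2) =
      ((i : ℚ) + j + 1 + c) / (i + j + 1) := by
    intro i j
    induction c with
    | zero => simp; rw [div_self]; positivity
    | succ c ih =>
      rw [Finset.prod_range_succ, ih]
      have : ((i + 1 : ℕ) : ℚ) + ((j + 1 : ℕ) : ℚ) + ((c + 1 : ℕ) : ℚ) - 2 = i + j + 1 + c := by
        push_cast; ring
      rw [this]
      push_cast
      field_simp
      ring
  have middle : ∀ i : ℕ, ∏ j ∈ Finset.range b, ((i : ℚ) + j + 1 + c) / (i + j + 1) =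
      ((b + c + i).factorial * i.factorial : ℚ) / ((b + i).factorial * (c + i).factorial) := by
    intro i
    induction b with
    | zero => simp; field_simp
    | succ b ih =>
      rw [Finset.prod_range_succ, ih, show b + 1 + c + i = (b + c + i) + 1 by ring,
        show b + 1 + i = (b + i) + 1 by ring, Nat.factorial_succ, Nat.factorial_succ]
      push_cast
      field_simp
      ring
  simp only [icc, inner, middle]
  rw [det_pathMatrix, Finset.prod_range]

/-! ### Nonintersecting lattice paths and determinants. -/

/-- The number of lattice paths with `n` steps from position `x` at time `t` to position `e`, where
a step keeps the position or, if this is allowed by `ok`, decreases it by one. -/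
def pathCount (ok : ℕ → ℤ → Bool) : ℕ → ℕ → ℤ → ℤ → ℚ
  | 0, _, x, e => if x = e then 1 else 0
  | n + 1, t, x, e => pathCount ok n (t + 1) x e +
      (if ok t x then 1 else 0) * pathCount ok n (t + 1) (x - 1) e

/-- The positions after one simultaneous step, `e` telling which paths move. -/
def move {a : ℕ} (s : Fin a → ℤ) (e : Fin a → Bool) : Fin a → ℤ :=
  fun j => s j - if e j then 1 else 0

/-- The positions at time `t` when `ε` tells which paths move at which time. -/
def positions {a n : ℕ} (s : Fin a → ℤ) (ε : Fin n → Fin a → Bool) (t : ℕ) : Fin a → ℤ :=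
  fun j => s j - ∑ k : Fin n, if (k : ℕ) < t ∧ ε k j then 1 else 0

/-- The paths starting at `s` and moving according to `ε` do not intersect, end at `e`
and use only allowed steps. -/
def IsFamily {a : ℕ} (ok : ℕ → ℤ → Bool) (e : Fin a → ℤ) (n t : ℕ) (s : Fin a → ℤ)
    (ε : Fin n → Fin a → Bool) : Prop :=
  (∀ k ≤ n, StrictMono (positions s ε k)) ∧ positions s ε n = e ∧
    ∀ (k : Fin n) (j : Fin a), ε k j → ok (t + k) (positions s ε k j)

section positions
variable {a n : ℕ}

theorem positions_zero (s : Fin a → ℤ) (ε : Fin n → Fin a → Bool) : positions s ε 0 = s := by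
  funext j
  simp [positions]

theorem positions_succ (s : Fin a → ℤ) (ε : Fin n → Fin a → Bool) (k : Fin n) (j : Fin a) :
    positions s ε (k + 1) j = positions s ε k j - if ε k j then 1 else 0 := by
  rw [positions, positions, sub_sub]
  congr 1
  rw [← Finset.sum_erase_add _ _ (Finset.mem_univ k),
    ← Finset.sum_erase_add (f := fun l : Fin n => if (l : ℕ) < k ∧ ε l j then (1 : ℤ) else 0) _
      (Finset.mem_univ k)]
  simp only [Nat.lt_succ_self, true_and, lt_irrefl, false_and, if_false,
    add_zero]
  congr 1
  refine Finset.sum_congr rfl fun l hl => ?_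
  have : (l : ℕ) ≠ k := fun h => Finset.ne_of_mem_erase hl (Fin.ext h)
  have h2 : (l : ℕ) < k + 1 ↔ (l : ℕ) < k := by omega
  simp only [h2]

theorem positions_cons_succ (s : Fin a → ℤ) (e : Fin a → Bool) (ε : Fin n → Fin a → Bool)
    (k : ℕ) :
    positions s (Fin.cons e ε : Fin (n + 1) → Fin a → Bool) (k + 1) = positions (move s e) ε k := by
  funext j
  rw [positions, positions, move, Fin.sum_univ_succ, sub_sub]
  simp

end positions

theorem isFamily_zero {a : ℕ} (ok : ℕ → ℤ → Bool) (e : Fin a → ℤ) (t : ℕ) (s : Fin a → ℤ)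
    (ε : Fin 0 → Fin a → Bool) : IsFamily ok e 0 t s ε ↔ StrictMono s ∧ s = e := by
  simp [IsFamily, positions_zero]

theorem isFamily_cons {a : ℕ} (ok : ℕ → ℤ → Bool) (e : Fin a → ℤ) (n t : ℕ) (s : Fin a → ℤ)
    (d : Fin a → Bool) (ε : Fin n → Fin a → Bool) :
    IsFamily ok e (n + 1) t s (Fin.cons d ε : Fin (n + 1) → Fin a → Bool) ↔
      StrictMono s ∧ (∀ j, d j → ok t (s j)) ∧ IsFamily ok e n (t + 1) (move s d) ε := by
  have h1 : (∀ k ≤ n + 1, StrictMono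
      (positions s (Fin.cons d ε : Fin (n + 1) → Fin a → Bool) k)) ↔
      StrictMono s ∧ ∀ k ≤ n, StrictMono (positions (move s d) ε k) := by
    constructor
    · intro h
      refine ⟨positions_zero s _ ▸ h 0 (by omega), fun k hk => ?_⟩
      rw [← positions_cons_succ]
      exact h _ (by omega)
    · rintro ⟨h0, h⟩ (_ | k) hk
      · rwa [positions_zero]
      · rw [positions_cons_succ]
        exact h _ (by omega)
  rw [IsFamily, IsFamily, h1, Fin.forall_fin_succ, positions_cons_succ]
  simp only [Fin.cons_zero, Fin.cons_succ, Fin.val_zero, Fin.val_succ, add_zero, positions_zero,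
    positions_cons_succ]
  have h2 : ∀ k : ℕ, t + 1 + k = t + (k + 1) := fun k => by omega
  simp only [h2]
  tauto

/-- An injection of `Fin a` into itself is onto, so both maps have the same range, which determines
a strictly increasing map. -/
theorem StrictMono.eq_of_forall_exists_eq {a : ℕ} {s e : Fin a → ℤ} (hs : StrictMono s)
    (he : StrictMono e) (h : ∀ i, ∃ j, s i = e j) : s = e := by
  choose f hf using h
  have hfi : Function.Injective f := fun i j hij => hs.injective (by rw [hf, hf, hij])
  refine (hs.range_inj he).1 ?_
  have : s = e ∘ f := funext hf
  rw [this, Set.range_comp, (Finite.surjective_of_injective hfi).range_eq, Set.image_univ]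

open Classical in
/-- The number of families of nonintersecting lattice paths is the determinant of the numbers of
lattice paths. -/
theorem card_isFamily_eq_det {a : ℕ} (ok : ℕ → ℤ → Bool) {e : Fin a → ℤ} (he : StrictMono e)
    (n t : ℕ) {s : Fin a → ℤ} (hs : StrictMono s) :
    ((Finset.univ.filter (IsFamily ok e n t s)).card : ℚ) =
      (Matrix.of fun i j => pathCount ok n t (s i) (e j)).det := by
  induction n generalizing t s with
  | zero =>
    by_cases h : s = e
    · subst h
      have : (Matrix.of fun i j => pathCount ok 0 t (s i) (s j)) = (1 : Matrix (Fin a) (Fin a) ℚ) := by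
        ext i j
        simp [pathCount, Matrix.one_apply, hs.injective.eq_iff]
      rw [this, Matrix.det_one, Finset.filter_true_of_mem]
      · simp
      · intro ε _
        exact (isFamily_zero ..).2 ⟨hs, rfl⟩
    -- Both tuples are increasing, so if they differ some starting point is no end point, and its
    -- row vanishes.
    · have : ∃ i, ∀ j, s i ≠ e j := by
        by_contra! hc
        exact h (StrictMono.eq_of_forall_exists_eq hs he hc)
      obtain ⟨i, hi⟩ := this
      rw [Matrix.det_eq_zero_of_row_eq_zero i (fun j => if_neg (hi j)), Finset.filter_false_of_mem]
      · simp
      · intro ε _ hε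
        exact h ((isFamily_zero ..).1 hε).2
  | succ n ih =>
    have hdet : (Matrix.of fun i j => pathCount ok (n + 1) t (s i) (e j)).det =
        ∑ d : Fin a → Bool, (∏ i, if d i then (if ok t (s i) then (1 : ℚ) else 0) else 1) *
          (Matrix.of fun i j => pathCount ok n (t + 1) (move s d i) (e j)).det := by
      -- Condition on the first step: every row is a sum of a "stay" row and a "move" row, and
      -- multilinearity expands the determinant over all simultaneous first steps `d`.
      have hrow : (fun i j => pathCount ok (n + 1) t (s i) (e j)) = fun i => ∑ d : Bool,
          (if d then (if ok t (s i) then (1 : ℚ) else 0) else 1) •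
            (fun j => pathCount ok n (t + 1) (s i - if d then 1 else 0) (e j)) := by
        funext i j
        by_cases h : ok t (s i) <;> simp [pathCount, h, add_comm]
      have h := (Matrix.detRowAlternating (n := Fin a) (R := ℚ)).toMultilinearMap.map_sum
        (fun (i : Fin a) (d : Bool) => (if d then (if ok t (s i) then (1 : ℚ) else 0) else 1) •
            (fun j => pathCount ok n (t + 1) (s i - if d then 1 else 0) (e j)))
      rw [← hrow] at h
      refine h.trans (Finset.sum_congr rfl fun d _ => ?_)
      exact (Matrix.detRowAlternating (n := Fin a) (R := ℚ)).toMultilinearMap.map_smul_univ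
        (fun i => if d i then (if ok t (s i) then (1 : ℚ) else 0) else 1)
        (fun i j => pathCount ok n (t + 1) (move s d i) (e j))
    rw [hdet, Finset.card_filter, Nat.cast_sum,
      ← (Fin.consEquiv fun _ : Fin (n + 1) => Fin a → Bool).sum_comp, Fintype.sum_prod_type]
    refine Finset.sum_congr rfl fun d _ => ?_
    have hc : ∀ ε : Fin n → Fin a → Bool,
        IsFamily ok e (n + 1) t s (Fin.consEquiv (fun _ => Fin a → Bool) (d, ε)) ↔
        StrictMono s ∧ (∀ j, d j → ok t (s j)) ∧ IsFamily ok e n (t + 1) (move s d) ε :=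
      fun ε => isFamily_cons ok e n t s d ε
    simp only [hc]
    by_cases hok : ∀ j, d j → ok t (s j)
    · have hprod : (∏ i, if d i then (if ok t (s i) then (1 : ℚ) else 0) else 1) = 1 :=
        Finset.prod_eq_one fun i _ => by
          split_ifs with h1 h2
          · rfl
          · exact absurd (hok i h1) h2
          · rfl
      rw [hprod, one_mul]
      by_cases hm : StrictMono (move s d)
      · rw [← ih (t + 1) hm, Finset.card_filter, Nat.cast_sum]
        simp only [and_iff_right hs, and_iff_right hok]
      -- Gaps are at least one and shrink by at most one per step, so paths cannot cross without
      -- meeting. A failure of strict monotonicity is a collision; it gives two equal rows and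
      -- determinant zero.
      · have hle : ∀ i j, i < j → move s d i ≤ move s d j := by
          intro i j hij
          have := hs hij
          unfold move
          split_ifs <;> omega
        obtain ⟨i, j, hij, hij'⟩ : ∃ i j, i < j ∧ move s d i = move s d j := by
          by_contra! hcon
          exact hm fun i j hij => lt_of_le_of_ne (hle i j hij) (hcon i j hij)
        rw [Matrix.det_zero_of_row_eq hij.ne (by ext l; simp only [Matrix.of_apply, hij'])]
        rw [← Nat.cast_sum, Nat.cast_eq_zero]
        refine Finset.sum_eq_zero fun ε _ => if_neg ?_
        rintro ⟨-, -, h, -⟩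
        exact hm (positions_zero (move s d) ε ▸ h 0 (Nat.zero_le _))
    · have hprod : (∏ i, if d i then (if ok t (s i) then (1 : ℚ) else 0) else 1) = 0 := by
        push Not at hok
        obtain ⟨i, h1, h2⟩ := hok
        exact Finset.prod_eq_zero (Finset.mem_univ i) (by simp [h1, h2])
      rw [hprod, zero_mul, ← Nat.cast_sum, Nat.cast_eq_zero]
      exact Finset.sum_eq_zero fun ε _ => if_neg fun h => hok h.2.1

theorem pathCount_of_forall_ok {ok : ℕ → ℤ → Bool} (n t : ℕ)
    (h : ∀ k, t ≤ k → k < t + n → ∀ x, ok k x) (x e : ℤ) :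
    pathCount ok n t x e = (binom n (x - e) : ℚ) := by
  induction n generalizing t x with
  | zero =>
    rw [pathCount, Nat.cast_zero, binom_zero_left]
    by_cases hx : x = e
    · simp [hx]
    · simp [hx, sub_eq_zero]
  | succ n ih =>
    rw [pathCount, ih _ fun k h1 h2 => h k (by omega) (by omega),
      ih _ fun k h1 h2 => h k (by omega) (by omega), if_pos (h t le_rfl (by omega) x),
      Nat.cast_succ, binom_succ, sub_right_comm]
    push_cast
    ring

/-- Forbidding a single step removes the paths through that step. -/
theorem pathCount_forbid (t₀ : ℕ) (x₀ : ℤ) (n t : ℕ) (h₁ : t ≤ t₀) (h₂ : t₀ < t + n) (x e : ℤ) :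
    pathCount (fun k z => !(k == t₀ && z == x₀)) n t x e =
      (binom n (x - e) : ℚ) - (binom ((t₀ : ℤ) - t) (x - x₀) : ℚ) *
        (binom ((t : ℤ) + n - 1 - t₀) (x₀ - 1 - e) : ℚ) := by
  induction n generalizing t x with
  | zero => omega
  | succ n ih =>
    rw [pathCount]
    -- At time `t₀` the first correction binomial is a delta at `x₀` and all later steps are free;
    -- before `t₀`, Pascal's rule applies to the unrestricted count and to the paths into the
    -- forbidden step.
    rcases h₁.eq_or_lt with rfl | h
    · have hok : ∀ k, t + 1 ≤ k → k < t + 1 + n → ∀ z : ℤ, (!(k == t && z == x₀)) = true := by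
        intro k hk _ z
        have : k ≠ t := by omega
        simp [this]
      rw [pathCount_of_forall_ok _ _ hok, pathCount_of_forall_ok _ _ hok, sub_self, binom_zero_left,
        show (t : ℤ) + (n + 1 : ℕ) - 1 - t = n by push_cast; ring, Nat.cast_succ, binom_succ]
      by_cases hx : x = x₀
      · subst hx
        simp [sub_right_comm]
      · simp [hx, sub_eq_zero, sub_right_comm, add_comm]
    · have hne : t ≠ t₀ := by omega
      rw [ih _ (by omega) (by omega), ih _ (by omega) (by omega), Nat.cast_succ n, binom_succ,
        show (t₀ : ℤ) - t = ((t₀ : ℤ) - (t + 1 : ℕ)) + 1 by push_cast; ring, binom_succ,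
        show ((t + 1 : ℕ) : ℤ) + n - 1 - t₀ = (t : ℤ) + (n + 1) - 1 - t₀ by push_cast; ring,
        sub_right_comm x 1 e, sub_right_comm x 1 x₀]
      simp [hne]
      ring

/-! ### The three kinds of rhombi and a local criterion for tilings. -/

/-- The unit rhombus with edges parallel to both axes. -/
def axisRhombus (x y : ℤ) : Finset UnitTriangle := {((x, y), false), ((x, y), true)}

/-- The unit rhombus with vertical sides and a side from `(x, y)` to `(x + 1, y + 1)`. -/
def verticalRhombus (x y : ℤ) : Finset UnitTriangle := {((x, y), true), ((x, y + 1), false)}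

theorem mem_hexagonTriangles_true (a b c : ℕ) (x y : ℤ) :
    ((x, y), true) ∈ hexagonTriangles a b c ↔
      0 ≤ x ∧ x < a + b ∧ 0 ≤ y ∧ y < a + c ∧ -(b : ℤ) ≤ y - x ∧ y - x < c := by
  rw [hexagonTriangles, Finset.mem_filter]
  simp only [UnitTriangle.vertices, Finset.mem_product,
    Finset.mem_Icc, Finset.mem_univ, InHexagon, Finset.mem_insert, Finset.mem_singleton,
    forall_eq_or_imp, forall_eq, and_true]
  omega

theorem mem_hexagonTriangles_false (a b c : ℕ) (x y : ℤ) :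
    ((x, y), false) ∈ hexagonTriangles a b c ↔
      0 ≤ x ∧ x < a + b ∧ 0 ≤ y ∧ y < a + c ∧ -(b : ℤ) < y - x ∧ y - x ≤ c := by
  rw [hexagonTriangles, Finset.mem_filter]
  simp only [UnitTriangle.vertices, Finset.mem_product,
    Finset.mem_Icc, Finset.mem_univ, InHexagon, Finset.mem_insert, Finset.mem_singleton,
    forall_eq_or_imp, forall_eq, and_true]
  omega

theorem card_vertices_inter_eq_sum (A B : Finset (ℤ × ℤ)) :
    (A ∩ B).card = ∑ v ∈ A, if v ∈ B then 1 else 0 := by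
  rw [← Finset.card_filter, Finset.filter_mem_eq_inter]

theorem card_vertices_true_inter_true (x y x' y' : ℤ) :
    (UnitTriangle.vertices ((x, y), true) ∩ UnitTriangle.vertices ((x', y'), true)).card ≠ 2 := by
  rw [card_vertices_inter_eq_sum]
  simp only [UnitTriangle.vertices]
  rw [Finset.sum_insert (by simp), Finset.sum_insert (by simp), Finset.sum_singleton]
  simp only [Finset.mem_insert, Finset.mem_singleton, Prod.mk.injEq, ne_eq]
  split_ifs <;> first | omega | exact not_false

theorem card_vertices_false_inter_false (x y x' y' : ℤ) :
    (UnitTriangle.vertices ((x, y), false) ∩ UnitTriangle.vertices ((x', y'), false)).card ≠ 2 := by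
  rw [card_vertices_inter_eq_sum]
  simp only [UnitTriangle.vertices]
  rw [Finset.sum_insert (by simp), Finset.sum_insert (by simp), Finset.sum_singleton]
  simp only [Finset.mem_insert, Finset.mem_singleton, Prod.mk.injEq, ne_eq]
  split_ifs <;> first | omega | exact not_false

theorem card_vertices_true_inter_false (x y x' y' : ℤ) :
    (UnitTriangle.vertices ((x, y), true) ∩ UnitTriangle.vertices ((x', y'), false)).card = 2 ↔
      x' = x ∧ y' = y ∨ x' = x - 1 ∧ y' = y ∨ x' = x ∧ y' = y + 1 := by
  rw [card_vertices_inter_eq_sum]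
  simp only [UnitTriangle.vertices]
  rw [Finset.sum_insert (by simp), Finset.sum_insert (by simp), Finset.sum_singleton]
  simp only [Finset.mem_insert, Finset.mem_singleton, Prod.mk.injEq]
  split_ifs <;> first | omega | (simp only [false_iff]; omega)

theorem pair_mem_hexagonRhombi (a b c : ℕ) {t u : UnitTriangle} (htu : t ≠ u) :
    {t, u} ∈ hexagonRhombi a b c ↔ t ∈ hexagonTriangles a b c ∧ u ∈ hexagonTriangles a b c ∧
      (UnitTriangle.vertices t ∩ UnitTriangle.vertices u).card = 2 := by
  simp only [hexagonRhombi, Finset.mem_filter, Finset.mem_powersetCard, Finset.card_pair htu,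
    Finset.insert_subset_iff, Finset.singleton_subset_iff, Finset.mem_insert,
    Finset.mem_singleton, forall_eq_or_imp, forall_eq]
  rw [Finset.inter_comm (UnitTriangle.vertices u)]
  have := htu.symm
  tauto

theorem mem_hexagonRhombi_cases {a b c : ℕ} {r : Finset UnitTriangle}
    (hr : r ∈ hexagonRhombi a b c) : (∃ x y, r = axisRhombus x y) ∨
      (∃ x y, r = horizontalRhombus x y) ∨ ∃ x y, r = verticalRhombus x y := by
  have hcard : r.card = 2 := (Finset.mem_powersetCard.1 (Finset.mem_filter.1 hr).1).2
  have key : ∀ x y x' y', r = {((x, y), true), ((x', y'), false)} →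
      (∃ x y, r = axisRhombus x y) ∨
      (∃ x y, r = horizontalRhombus x y) ∨ ∃ x y, r = verticalRhombus x y := by
    intro x y x' y' h
    rw [h, pair_mem_hexagonRhombi a b c (by simp)] at hr
    rcases (card_vertices_true_inter_false x y x' y').1 hr.2.2 with ⟨rfl, rfl⟩ | ⟨rfl, rfl⟩ |
      ⟨rfl, rfl⟩
    · exact Or.inl ⟨x', y', h.trans (Finset.pair_comm _ _)⟩
    · exact Or.inr (Or.inl ⟨x, y', h.trans (Finset.pair_comm _ _)⟩)
    · exact Or.inr (Or.inr ⟨x', y, h⟩)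
  obtain ⟨⟨⟨x, y⟩, o⟩, ⟨⟨x', y'⟩, o'⟩, hne, h⟩ := Finset.card_eq_two.1 hcard
  cases o <;> cases o'
  · rw [h, pair_mem_hexagonRhombi a b c hne] at hr
    exact absurd hr.2.2 (card_vertices_false_inter_false _ _ _ _)
  · exact key _ _ _ _ (h.trans (Finset.pair_comm _ _))
  · exact key _ _ _ _ h
  · rw [h, pair_mem_hexagonRhombi a b c hne] at hr
    exact absurd hr.2.2 (card_vertices_true_inter_true _ _ _ _)

theorem axisRhombus_mem (a b c : ℕ) (x y : ℤ) : axisRhombus x y ∈ hexagonRhombi a b c ↔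
    0 ≤ x ∧ x < a + b ∧ 0 ≤ y ∧ y < a + c ∧ -(b : ℤ) < y - x ∧ y - x < c := by
  rw [axisRhombus, pair_mem_hexagonRhombi a b c (by simp), Finset.inter_comm,
    card_vertices_true_inter_false, mem_hexagonTriangles_true, mem_hexagonTriangles_false]
  omega

theorem horizontalRhombus_mem (a b c : ℕ) (x y : ℤ) :
    horizontalRhombus x y ∈ hexagonRhombi a b c ↔
      1 ≤ x ∧ x < a + b ∧ 0 ≤ y ∧ y < a + c ∧ -(b : ℤ) ≤ y - x ∧ y - x < c := by
  rw [horizontalRhombus, pair_mem_hexagonRhombi a b c (by simp), Finset.inter_comm,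
    card_vertices_true_inter_false, mem_hexagonTriangles_true, mem_hexagonTriangles_false]
  omega

theorem verticalRhombus_mem (a b c : ℕ) (x y : ℤ) :
    verticalRhombus x y ∈ hexagonRhombi a b c ↔
      0 ≤ x ∧ x < a + b ∧ 0 ≤ y ∧ y + 1 < a + c ∧ -(b : ℤ) ≤ y - x ∧ y - x < c := by
  rw [verticalRhombus, pair_mem_hexagonRhombi a b c (by simp),
    card_vertices_true_inter_false, mem_hexagonTriangles_true, mem_hexagonTriangles_false]
  omega

section membership
variable (x y x' y' : ℤ)

theorem true_mem_axisRhombus : ((x, y), true) ∈ axisRhombus x' y' ↔ x' = x ∧ y' = y := by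
  simp [axisRhombus, eq_comm]

theorem false_mem_axisRhombus : ((x, y), false) ∈ axisRhombus x' y' ↔ x' = x ∧ y' = y := by
  simp [axisRhombus, eq_comm]

theorem true_mem_horizontalRhombus :
    ((x, y), true) ∈ horizontalRhombus x' y' ↔ x' = x ∧ y' = y := by
  simp [horizontalRhombus, eq_comm]

theorem false_mem_horizontalRhombus :
    ((x, y), false) ∈ horizontalRhombus x' y' ↔ x' = x + 1 ∧ y' = y := by
  simp [horizontalRhombus]
  omega

theorem true_mem_verticalRhombus :
    ((x, y), true) ∈ verticalRhombus x' y' ↔ x' = x ∧ y' = y := by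
  simp [verticalRhombus, eq_comm]

theorem false_mem_verticalRhombus :
    ((x, y), false) ∈ verticalRhombus x' y' ↔ x' = x ∧ y' = y - 1 := by
  simp [verticalRhombus]
  omega

theorem axisRhombus_inj : axisRhombus x y = axisRhombus x' y' ↔ x' = x ∧ y' = y := by
  refine ⟨fun h => ?_, fun h => by rw [h.1, h.2]⟩
  rw [← true_mem_axisRhombus, ← h, true_mem_axisRhombus]
  exact ⟨rfl, rfl⟩

theorem horizontalRhombus_inj :
    horizontalRhombus x y = horizontalRhombus x' y' ↔ x' = x ∧ y' = y := by
  refine ⟨fun h => ?_, fun h => by rw [h.1, h.2]⟩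
  rw [← true_mem_horizontalRhombus, ← h, true_mem_horizontalRhombus]
  exact ⟨rfl, rfl⟩

theorem verticalRhombus_inj :
    verticalRhombus x y = verticalRhombus x' y' ↔ x' = x ∧ y' = y := by
  refine ⟨fun h => ?_, fun h => by rw [h.1, h.2]⟩
  rw [← true_mem_verticalRhombus, ← h, true_mem_verticalRhombus]
  exact ⟨rfl, rfl⟩

theorem axisRhombus_ne_horizontalRhombus : axisRhombus x y ≠ horizontalRhombus x' y' := by
  intro h
  have h1 := (true_mem_axisRhombus x y x y).2 ⟨rfl, rfl⟩
  have h2 := (false_mem_axisRhombus x y x y).2 ⟨rfl, rfl⟩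
  rw [h, true_mem_horizontalRhombus] at h1
  rw [h, false_mem_horizontalRhombus] at h2
  omega

theorem axisRhombus_ne_verticalRhombus : axisRhombus x y ≠ verticalRhombus x' y' := by
  intro h
  have h1 := (true_mem_axisRhombus x y x y).2 ⟨rfl, rfl⟩
  have h2 := (false_mem_axisRhombus x y x y).2 ⟨rfl, rfl⟩
  rw [h, true_mem_verticalRhombus] at h1
  rw [h, false_mem_verticalRhombus] at h2
  omega

theorem horizontalRhombus_ne_verticalRhombus :
    horizontalRhombus x y ≠ verticalRhombus x' y' := by
  intro h
  have h1 := (true_mem_horizontalRhombus x y x y).2 ⟨rfl, rfl⟩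
  have h2 := (false_mem_horizontalRhombus (x - 1) y x y).2 ⟨by ring, rfl⟩
  rw [h, true_mem_verticalRhombus] at h1
  rw [h, false_mem_verticalRhombus] at h2
  omega

end membership

/-- Exactly one of three propositions holds. -/
def ExactlyOne (p q r : Prop) : Prop :=
  (p ∧ ¬q ∧ ¬r) ∨ (¬p ∧ q ∧ ¬r) ∨ (¬p ∧ ¬q ∧ r)

theorem card_filter_mem_eq_one_iff {T : Finset (Finset UnitTriangle)} {t : UnitTriangle}
    {p q r : Finset UnitTriangle} (hpq : p ≠ q) (hpr : p ≠ r) (hqr : q ≠ r)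
    (h : ∀ s ∈ T, t ∈ s ↔ s = p ∨ s = q ∨ s = r) :
    (T.filter fun s => t ∈ s).card = 1 ↔ ExactlyOne (p ∈ T) (q ∈ T) (r ∈ T) := by
  have : (T.filter fun s => t ∈ s) = ({p, q, r} : Finset (Finset UnitTriangle)).filter (· ∈ T) := by
    ext s
    simp only [Finset.mem_filter, Finset.mem_insert, Finset.mem_singleton]
    constructor
    · rintro ⟨h1, h2⟩
      exact ⟨(h s h1).1 h2, h1⟩
    · rintro ⟨h1, h2⟩
      exact ⟨h2, (h s h2).2 h1⟩
  rw [this, Finset.card_filter, Finset.sum_insert (by simp [hpq, hpr]),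
    Finset.sum_insert (by simp [hqr]), Finset.sum_singleton, ExactlyOne]
  split_ifs <;> simp [*]

/-- Each triangle lies in just one rhombus of each kind, so covering it once is a choice among
three. -/
theorem mem_tilings_iff (a b c : ℕ) (T : Finset (Finset UnitTriangle)) :
    T ∈ tilings a b c ↔ T ⊆ hexagonRhombi a b c ∧
      (∀ x y, ((x, y), true) ∈ hexagonTriangles a b c →
        ExactlyOne (axisRhombus x y ∈ T) (horizontalRhombus x y ∈ T) (verticalRhombus x y ∈ T)) ∧
      (∀ x y, ((x, y), false) ∈ hexagonTriangles a b c →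
        ExactlyOne (axisRhombus x y ∈ T) (horizontalRhombus (x + 1) y ∈ T)
          (verticalRhombus x (y - 1) ∈ T)) := by
  rw [tilings, Finset.mem_filter, Finset.mem_powerset]
  refine and_congr_right fun hT => ?_
  have h1 : ∀ x y, (T.filter fun r => ((x, y), true) ∈ r).card = 1 ↔
      ExactlyOne (axisRhombus x y ∈ T) (horizontalRhombus x y ∈ T)
        (verticalRhombus x y ∈ T) := by
    intro x y
    refine card_filter_mem_eq_one_iff (axisRhombus_ne_horizontalRhombus _ _ _ _)
      (axisRhombus_ne_verticalRhombus _ _ _ _) (horizontalRhombus_ne_verticalRhombus _ _ _ _) fun s hs => ?_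
    rcases mem_hexagonRhombi_cases (hT hs) with ⟨x', y', rfl⟩ | ⟨x', y', rfl⟩ | ⟨x', y', rfl⟩
    · simp [true_mem_axisRhombus, axisRhombus_inj, axisRhombus_ne_horizontalRhombus,
        axisRhombus_ne_verticalRhombus, eq_comm]
    · simp [true_mem_horizontalRhombus, horizontalRhombus_inj,
        (axisRhombus_ne_horizontalRhombus _ _ _ _).symm, horizontalRhombus_ne_verticalRhombus, eq_comm]
    · simp [true_mem_verticalRhombus, verticalRhombus_inj,
        (axisRhombus_ne_verticalRhombus _ _ _ _).symm, (horizontalRhombus_ne_verticalRhombus _ _ _ _).symm,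
        eq_comm]
  have h2 : ∀ x y, (T.filter fun r => ((x, y), false) ∈ r).card = 1 ↔
      ExactlyOne (axisRhombus x y ∈ T) (horizontalRhombus (x + 1) y ∈ T)
        (verticalRhombus x (y - 1) ∈ T) := by
    intro x y
    refine card_filter_mem_eq_one_iff (axisRhombus_ne_horizontalRhombus _ _ _ _)
      (axisRhombus_ne_verticalRhombus _ _ _ _) (horizontalRhombus_ne_verticalRhombus _ _ _ _) fun s hs => ?_
    rcases mem_hexagonRhombi_cases (hT hs) with ⟨x', y', rfl⟩ | ⟨x', y', rfl⟩ | ⟨x', y', rfl⟩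
    · simp [false_mem_axisRhombus, axisRhombus_inj, axisRhombus_ne_horizontalRhombus,
        axisRhombus_ne_verticalRhombus, eq_comm]
    · simp [false_mem_horizontalRhombus, horizontalRhombus_inj,
        (axisRhombus_ne_horizontalRhombus _ _ _ _).symm, horizontalRhombus_ne_verticalRhombus, eq_comm]
    · simp [false_mem_verticalRhombus, verticalRhombus_inj,
        (axisRhombus_ne_verticalRhombus _ _ _ _).symm, (horizontalRhombus_ne_verticalRhombus _ _ _ _).symm,
        eq_comm]
  constructor
  · exact fun h => ⟨fun x y ht => (h1 x y).1 (h _ ht), fun x y ht => (h2 x y).1 (h _ ht)⟩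
  · rintro ⟨h3, h4⟩ ⟨⟨x, y⟩, o⟩ ht
    cases o
    · exact (h2 x y).2 (h4 x y ht)
    · exact (h1 x y).2 (h3 x y ht)

open Classical in
/-- The rhombi in the hexagon of the three kinds at the positions described by `p`, `q`, `r`. -/
noncomputable def rhombiAt (a b c : ℕ) (p q r : ℤ → ℤ → Prop) : Finset (Finset UnitTriangle) :=
  (hexagonRhombi a b c).filter fun s => (∀ x y, s = axisRhombus x y → p x y) ∧
    (∀ x y, s = horizontalRhombus x y → q x y) ∧ ∀ x y, s = verticalRhombus x y → r x y

section rhombiAt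
variable (a b c : ℕ) (p q r : ℤ → ℤ → Prop) (x y : ℤ)

theorem axisRhombus_mem_rhombiAt : axisRhombus x y ∈ rhombiAt a b c p q r ↔
    axisRhombus x y ∈ hexagonRhombi a b c ∧ p x y := by
  simp only [rhombiAt, Finset.mem_filter, axisRhombus_inj, axisRhombus_ne_horizontalRhombus,
    axisRhombus_ne_verticalRhombus, false_imp_iff, implies_true, and_true]
  refine and_congr_right fun _ => ⟨fun h => h x y ⟨rfl, rfl⟩, ?_⟩
  rintro h _ _ ⟨rfl, rfl⟩
  exact h

theorem horizontalRhombus_mem_rhombiAt : horizontalRhombus x y ∈ rhombiAt a b c p q r ↔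
    horizontalRhombus x y ∈ hexagonRhombi a b c ∧ q x y := by
  simp only [rhombiAt, Finset.mem_filter, horizontalRhombus_inj,
    (axisRhombus_ne_horizontalRhombus _ _ _ _).symm,
    horizontalRhombus_ne_verticalRhombus, false_imp_iff, implies_true, and_true, true_and]
  refine and_congr_right fun _ => ⟨fun h => h x y ⟨rfl, rfl⟩, ?_⟩
  rintro h _ _ ⟨rfl, rfl⟩
  exact h

theorem verticalRhombus_mem_rhombiAt : verticalRhombus x y ∈ rhombiAt a b c p q r ↔
    verticalRhombus x y ∈ hexagonRhombi a b c ∧ r x y := by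
  simp only [rhombiAt, Finset.mem_filter, verticalRhombus_inj,
    (axisRhombus_ne_verticalRhombus _ _ _ _).symm,
    (horizontalRhombus_ne_verticalRhombus _ _ _ _).symm, false_imp_iff, implies_true, true_and]
  refine and_congr_right fun _ => ⟨fun h => h x y ⟨rfl, rfl⟩, ?_⟩
  rintro h _ _ ⟨rfl, rfl⟩
  exact h

open Classical in
theorem rhombiAt_eq {T : Finset (Finset UnitTriangle)} (hT : T ⊆ hexagonRhombi a b c)
    (hp : ∀ x y, axisRhombus x y ∈ hexagonRhombi a b c → (p x y ↔ axisRhombus x y ∈ T))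
    (hq : ∀ x y, horizontalRhombus x y ∈ hexagonRhombi a b c → (q x y ↔ horizontalRhombus x y ∈ T))
    (hr : ∀ x y, verticalRhombus x y ∈ hexagonRhombi a b c → (r x y ↔ verticalRhombus x y ∈ T)) :
    rhombiAt a b c p q r = T := by
  have key : ∀ s ∈ hexagonRhombi a b c, s ∈ rhombiAt a b c p q r ↔ s ∈ T := by
    intro s hs
    rcases mem_hexagonRhombi_cases hs with ⟨x, y, rfl⟩ | ⟨x, y, rfl⟩ | ⟨x, y, rfl⟩
    · rw [axisRhombus_mem_rhombiAt, and_iff_right hs, hp x y hs]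
    · rw [horizontalRhombus_mem_rhombiAt, and_iff_right hs, hq x y hs]
    · rw [verticalRhombus_mem_rhombiAt, and_iff_right hs, hr x y hs]
  ext s
  refine ⟨fun h => (key s (Finset.mem_filter.1 h).1).1 h, fun h => (key s (hT h)).2 h⟩

end rhombiAt

/-! ### From paths to tilings. -/

/-- The positions, slice by slice, of nonintersecting lattice paths between the two sides of
length `a` of the hexagon. -/
structure IsPaths (a b c : ℕ) (s : ℕ → Fin a → ℤ) : Prop where
  zero : ∀ j, s 0 j = b + (j : ℕ)
  last : ∀ j, s (b + c) j = (j : ℕ)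
  step : ∀ t < b + c, ∀ j, s (t + 1) j = s t j ∨ s (t + 1) j = s t j - 1
  mono : ∀ t ≤ b + c, StrictMono (s t)

/-- The tiling in which the paths at positions `s` run through the horizontal and vertical
rhombi. -/
noncomputable def tilingOf (a b c : ℕ) (s : ℕ → Fin a → ℤ) : Finset (Finset UnitTriangle) :=
  rhombiAt a b c (fun x y => ∀ j, s (y - x + b).toNat j ≠ x)
    (fun x y => ∃ j, s (y - x + b).toNat j = x ∧ s ((y - x + b).toNat + 1) j = x - 1)
    (fun x y => ∃ j, s (y - x + b).toNat j = x ∧ s ((y - x + b).toNat + 1) j = x)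

open Classical in
/-- The positions of the paths that run through the horizontal and vertical rhombi of `T`. -/
noncomputable def positionsOf (a b : ℕ) (T : Finset (Finset UnitTriangle)) : ℕ → Fin a → ℤ
  | 0 => fun j => b + (j : ℕ)
  | t + 1 => fun j => positionsOf a b T t j -
      if horizontalRhombus (positionsOf a b T t j) (positionsOf a b T t j + t - b) ∈ T then 1 else 0

/-- Slice `t` consists of the edges from `(x, y)` to `(x + 1, y + 1)` with `y - x = t - b`. Writing
`y = x + t - b` makes `(t, x)` the time and position of a path. -/
theorem toNat_slice (x : ℤ) (t b : ℕ) : (x + t - b - x + b : ℤ).toNat = t := by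
  omega

section tilingOf
variable {a b c : ℕ} {s : ℕ → Fin a → ℤ}

theorem IsPaths.bounds_start (h : IsPaths a b c s) {t : ℕ} (ht : t ≤ b + c) (j : Fin a) :
    (b : ℤ) + (j : ℕ) - t ≤ s t j ∧ s t j ≤ b + (j : ℕ) := by
  induction t with
  | zero => simp [h.zero]
  | succ t ih =>
    have := ih (by omega)
    have := h.step t (by omega) j
    push_cast
    omega

theorem IsPaths.bounds_end (h : IsPaths a b c s) {t k : ℕ} (ht : t + k = b + c) (j : Fin a) :
    (j : ℕ) ≤ s t j ∧ s t j ≤ (j : ℕ) + k := by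
  induction k generalizing t with
  | zero =>
    obtain rfl : t = b + c := ht
    simp [h.last]
  | succ k ih =>
    have := ih (t := t + 1) (by omega)
    have := h.step t (by omega) j
    push_cast
    omega

theorem IsPaths.bounds (h : IsPaths a b c s) {t : ℕ} (ht : t ≤ b + c) (j : Fin a) :
    0 ≤ s t j ∧ s t j < a + b ∧ 0 ≤ s t j + t - b ∧ s t j + t - b < a + c := by
  have := h.bounds_start ht j
  have := h.bounds_end (show t + (b + c - t) = b + c by omega) j
  omega

theorem axisRhombus_mem_tilingOf (x : ℤ) (t : ℕ) :
    axisRhombus x (x + t - b) ∈ tilingOf a b c s ↔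
      axisRhombus x (x + t - b) ∈ hexagonRhombi a b c ∧ ∀ j, s t j ≠ x := by
  rw [tilingOf, axisRhombus_mem_rhombiAt, toNat_slice]

theorem horizontalRhombus_mem_tilingOf (x : ℤ) (t : ℕ) :
    horizontalRhombus x (x + t - b) ∈ tilingOf a b c s ↔
      horizontalRhombus x (x + t - b) ∈ hexagonRhombi a b c ∧
        ∃ j, s t j = x ∧ s (t + 1) j = x - 1 := by
  rw [tilingOf, horizontalRhombus_mem_rhombiAt, toNat_slice]

theorem verticalRhombus_mem_tilingOf (x : ℤ) (t : ℕ) :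
    verticalRhombus x (x + t - b) ∈ tilingOf a b c s ↔
      verticalRhombus x (x + t - b) ∈ hexagonRhombi a b c ∧
        ∃ j, s t j = x ∧ s (t + 1) j = x := by
  rw [tilingOf, verticalRhombus_mem_rhombiAt, toNat_slice]

/-- An upper triangle is entered from slice `t`, a lower one is left into slice `t + 1`. If a path
uses that edge, its step selects the horizontal or the vertical rhombus, uniquely because paths do
not meet; otherwise the axis rhombus covers the triangle. -/
theorem tilingOf_mem_tilings (h : IsPaths a b c s) : tilingOf a b c s ∈ tilings a b c := by
  classical
  rw [mem_tilings_iff]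
  refine ⟨Finset.filter_subset _ _, fun x y ht => ?_, fun x y ht => ?_⟩
  · rw [mem_hexagonTriangles_true] at ht
    obtain ⟨t, rfl⟩ : ∃ t : ℕ, y = x + t - b := ⟨(y - x + b).toNat, by omega⟩
    have htN : t < b + c := by omega
    rw [axisRhombus_mem_tilingOf, horizontalRhombus_mem_tilingOf, verticalRhombus_mem_tilingOf,
      axisRhombus_mem, horizontalRhombus_mem, verticalRhombus_mem]
    by_cases hx : ∃ j, s t j = x
    · obtain ⟨j, hj⟩ := hx
      have huniq : ∀ i, s t i = x → i = j := fun i hi =>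
        (h.mono t htN.le).injective (hi.trans hj.symm)
      have hb := h.bounds (t := t + 1) (by omega) j
      push_cast at hb
      rcases h.step t htN j with hs | hs
      · refine Or.inr (Or.inr ⟨fun h => h.2 j hj, ?_, ⟨by omega, j, hj, by omega⟩⟩)
        rintro ⟨-, i, hi, hi'⟩
        obtain rfl := huniq i hi
        omega
      · refine Or.inr (Or.inl ⟨fun h => h.2 j hj, ⟨by omega, j, hj, by omega⟩, ?_⟩)
        rintro ⟨-, i, hi, hi'⟩
        obtain rfl := huniq i hi
        omega
    · push Not at hx
      refine Or.inl ⟨⟨?_, hx⟩, fun ⟨_, j, hj, _⟩ => hx j hj, fun ⟨_, j, hj, _⟩ => hx j hj⟩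
      -- On the first slice every edge is a starting point, so an unused edge is interior and its
      -- axis rhombus fits in the hexagon; likewise below for the last slice.
      have : t ≠ 0 := by
        rintro rfl
        refine hx ⟨(x - b).toNat, by omega⟩ ?_
        rw [h.zero]
        simp only
        omega
      omega
  · rw [mem_hexagonTriangles_false] at ht
    obtain ⟨t, rfl⟩ : ∃ t : ℕ, y = x + (t + 1 : ℕ) - b := ⟨(y - x + b - 1).toNat, by omega⟩
    have htN : t < b + c := by omega
    have e1 : horizontalRhombus (x + 1) (x + (t + 1 : ℕ) - b) =
        horizontalRhombus (x + 1) ((x + 1) + t - b) := by congr 1; push_cast; ring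
    have e2 : verticalRhombus x (x + (t + 1 : ℕ) - b - 1) = verticalRhombus x (x + t - b) := by
      congr 1; push_cast; ring
    rw [e1, e2, axisRhombus_mem_tilingOf, horizontalRhombus_mem_tilingOf,
      verticalRhombus_mem_tilingOf, axisRhombus_mem, horizontalRhombus_mem, verticalRhombus_mem]
    by_cases hx : ∃ j, s (t + 1) j = x
    · obtain ⟨j, hj⟩ := hx
      have huniq : ∀ i, s (t + 1) i = x → i = j := fun i hi =>
        (h.mono (t + 1) htN).injective (hi.trans hj.symm)
      have hb := h.bounds (t := t) (by omega) j
      push_cast at ht ⊢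
      rcases h.step t htN j with hs | hs
      · refine Or.inr (Or.inr ⟨fun h => h.2 j hj, ?_, ⟨by omega, j, by omega, hj⟩⟩)
        rintro ⟨-, i, hi, hi'⟩
        obtain rfl := huniq i (by omega)
        omega
      · refine Or.inr (Or.inl ⟨fun h => h.2 j hj, ⟨by omega, j, by omega, by omega⟩, ?_⟩)
        rintro ⟨-, i, hi, hi'⟩
        obtain rfl := huniq i hi'
        omega
    · push Not at hx
      refine Or.inl ⟨⟨?_, hx⟩, fun ⟨_, j, _, hj⟩ => hx j (by omega), fun ⟨_, j, _, hj⟩ => hx j hj⟩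
      have : t + 1 ≠ b + c := by
        intro htc
        refine hx ⟨x.toNat, by omega⟩ ?_
        rw [htc, h.last]
        simp only
        omega
      push_cast at ht ⊢
      omega

theorem horizontalRhombus_position_mem_tilingOf (h : IsPaths a b c s) {t : ℕ} (ht : t < b + c)
    (j : Fin a) : horizontalRhombus (s t j) (s t j + t - b) ∈ tilingOf a b c s ↔
      s (t + 1) j = s t j - 1 := by
  rw [horizontalRhombus_mem_tilingOf, horizontalRhombus_mem]
  constructor
  · rintro ⟨-, i, hi, hi'⟩
    obtain rfl := (h.mono t ht.le).injective hi
    exact hi'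
  · intro hj
    have h1 := h.bounds ht.le j
    have h2 := h.bounds (t := t + 1) ht j
    exact ⟨by omega, j, rfl, hj⟩

theorem positionsOf_tilingOf (h : IsPaths a b c s) {t : ℕ} (ht : t ≤ b + c) :
    positionsOf a b (tilingOf a b c s) t = s t := by
  induction t with
  | zero => funext j; rw [positionsOf, h.zero]
  | succ t ih =>
    funext j
    rw [positionsOf, ih (by omega)]
    simp only [horizontalRhombus_position_mem_tilingOf h ht]
    have := h.step t ht j
    split_ifs <;> omega

end tilingOf

/-! ### From tilings to paths. -/

section positionsOf
variable {a b c : ℕ} {T : Finset (Finset UnitTriangle)}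

/-- The paths of a tiling do not intersect and run through all edges that are not diagonals of
rhombi of the tiling. -/
theorem positionsOf_spec (hT : T ∈ tilings a b c) {t : ℕ} (ht : t ≤ b + c) :
    StrictMono (positionsOf a b T t) ∧
      (∀ j, 0 ≤ positionsOf a b T t j ∧ positionsOf a b T t j < a + b ∧
        0 ≤ positionsOf a b T t j + t - b ∧ positionsOf a b T t j + t - b < a + c) ∧
      ∀ x : ℤ, 0 ≤ x → x < a + b → 0 ≤ x + t - b → x + t - b < a + c →
        (axisRhombus x (x + t - b) ∈ T ↔ ∀ j, positionsOf a b T t j ≠ x) := by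
  classical
  rw [mem_tilings_iff] at hT
  obtain ⟨hsub, htrue, hfalse⟩ := hT
  induction t with
  | zero =>
    refine ⟨fun i j hij => by simpa [positionsOf] using hij, fun j => ?_, fun x h1 h2 h3 h4 => ?_⟩
    · simp only [positionsOf]
      omega
    · refine iff_of_false (fun h => ?_) fun h => h ⟨(x - b).toNat, by omega⟩ ?_
      · have := (axisRhombus_mem ..).1 (hsub h)
        omega
      · simp only [positionsOf]
        omega
  | succ t ih =>
    obtain ⟨hmono, hbd, hax⟩ := ih (by omega)
    set s := positionsOf a b T t with hs
    set s' := positionsOf a b T (t + 1) with hs'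
    have hstep : ∀ j, s' j = s j - if horizontalRhombus (s j) (s j + t - b) ∈ T then 1 else 0 :=
      fun j => rfl
    have htr : ∀ x : ℤ, 0 ≤ x → x < a + b → 0 ≤ x + t - b → x + t - b < a + c →
        ExactlyOne (axisRhombus x (x + t - b) ∈ T) (horizontalRhombus x (x + t - b) ∈ T)
          (verticalRhombus x (x + t - b) ∈ T) := fun x h1 h2 h3 h4 =>
      htrue _ _ ((mem_hexagonTriangles_true ..).2 (by omega))
    have hfa : ∀ x : ℤ, 0 ≤ x → x < a + b → 0 ≤ x + t + 1 - b → x + t + 1 - b < a + c →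
        ExactlyOne (axisRhombus x (x + t + 1 - b) ∈ T)
          (horizontalRhombus (x + 1) (x + 1 + t - b) ∈ T)
          (verticalRhombus x (x + t - b) ∈ T) := by
      intro x h1 h2 h3 h4
      have := hfalse x (x + t + 1 - b) ((mem_hexagonTriangles_false ..).2 (by omega))
      rwa [show x + t + 1 - b - 1 = x + t - (b : ℤ) by ring,
        show horizontalRhombus (x + 1) (x + t + 1 - b) =
          horizontalRhombus (x + 1) (x + 1 + t - b) by congr 1; ring] at this
    have hcases : ∀ j, (horizontalRhombus (s j) (s j + t - b) ∈ T ∧ s' j = s j - 1) ∨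
        (verticalRhombus (s j) (s j + t - b) ∈ T ∧ s' j = s j) := by
      intro j
      obtain ⟨h1, h2, h3, h4⟩ := hbd j
      have hna : axisRhombus (s j) (s j + t - b) ∉ T := fun h =>
        (hax (s j) h1 h2 h3 h4).1 h j rfl
      have hj := hstep j
      rcases htr (s j) h1 h2 h3 h4 with h | h | h
      · exact absurd h.1 hna
      · rw [if_pos h.2.1] at hj
        exact Or.inl ⟨h.2.1, hj⟩
      · rw [if_neg h.2.1, sub_zero] at hj
        exact Or.inr ⟨h.2.2, hj⟩
    have hbd' : ∀ j, 0 ≤ s' j ∧ s' j < a + b ∧ 0 ≤ s' j + t + 1 - b ∧ s' j + t + 1 - b < a + c := by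
      intro j
      have := hbd j
      rcases hcases j with ⟨h, hj⟩ | ⟨h, hj⟩
      · have := (horizontalRhombus_mem ..).1 (hsub h)
        omega
      · have := (verticalRhombus_mem ..).1 (hsub h)
        omega
    have hcov : ∀ x, (∃ j, s' j = x) → axisRhombus x (x + t + 1 - b) ∉ T := by
      rintro x ⟨j, rfl⟩
      obtain ⟨h1, h2, h3, h4⟩ := hbd' j
      rcases hcases j with ⟨h, hj⟩ | ⟨h, hj⟩
      · have hx : s j = s' j + 1 := by omega
        rw [hx] at h
        rcases hfa _ h1 h2 h3 h4 with h' | h' | h' <;> tauto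
      · rw [← hj] at h
        rcases hfa _ h1 h2 h3 h4 with h' | h' | h' <;> tauto
    refine ⟨fun i j hij => ?_, fun j => ?_, fun x h1 h2 h3 h4 => ?_⟩
    · have hlt := hmono hij
      rcases hcases i with ⟨hi, hi'⟩ | ⟨hi, hi'⟩ <;> rcases hcases j with ⟨hj, hj'⟩ | ⟨hj, hj'⟩
      · omega
      · omega
      -- If the left path stays and its right neighbour moves onto it, the vertical and the
      -- horizontal rhombus used share a lower triangle.
      · by_contra hcon
        have hx : s j = s i + 1 := by omega
        rw [hx] at hj
        obtain ⟨h1, h2, h3, h4⟩ := hbd' i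
        rw [hi'] at h1 h2 h3 h4
        rcases hfa _ h1 h2 h3 h4 with h' | h' | h' <;> tauto
      · omega
    · have := hbd' j
      push_cast
      omega
    · have e : x + ((t + 1 : ℕ) : ℤ) - b = x + t + 1 - b := by push_cast; ring
      rw [e] at h3 h4 ⊢
      refine ⟨fun h j hj => hcov x ⟨j, hj⟩ h, fun h => ?_⟩
      by_contra hna
      -- A horizontal or vertical rhombus of `T` excludes the axis rhombus on its edge in slice `t`,
      -- so by induction a path arrives there: paths never start in the interior.
      have hpart : ∀ z, horizontalRhombus z (z + t - b) ∈ T ∨ verticalRhombus z (z + t - b) ∈ T →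
          ∃ j, s j = z := by
        intro z hz
        have hz' : 0 ≤ z ∧ z < a + b ∧ 0 ≤ z + t - b ∧ z + t - b < a + c := by
          rcases hz with hz | hz
          · have := (horizontalRhombus_mem ..).1 (hsub hz)
            omega
          · have := (verticalRhombus_mem ..).1 (hsub hz)
            omega
        obtain ⟨g1, g2, g3, g4⟩ := hz'
        have hz2 : axisRhombus z (z + t - b) ∉ T := by
          rcases htr z g1 g2 g3 g4 with h' | h' | h' <;> tauto
        rw [hax z g1 g2 g3 g4] at hz2
        push Not at hz2
        exact hz2
      rcases hfa x h1 h2 h3 h4 with h' | h' | h'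
      · exact hna h'.1
      · obtain ⟨j, hj⟩ := hpart (x + 1) (Or.inl h'.2.1)
        have := hstep j
        rw [hj, if_pos h'.2.1] at this
        exact h j (by omega)
      · obtain ⟨j, hj⟩ := hpart x (Or.inr h'.2.2)
        rcases hcases j with ⟨hj1, hj2⟩ | ⟨hj1, hj2⟩
        · rw [hj] at hj1
          obtain ⟨g1, g2, g3, g4⟩ := hbd j
          rw [hj] at g1 g2 g3 g4
          rcases htr x g1 g2 g3 g4 with h'' | h'' | h'' <;> tauto
        · exact h j (hj2.trans hj)

theorem isPaths_positionsOf (hT : T ∈ tilings a b c) : IsPaths a b c (positionsOf a b T) where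
  zero _ := rfl
  last := by
    obtain ⟨hmono, hbd, hax⟩ := positionsOf_spec hT le_rfl
    have hid : StrictMono fun j : Fin a => ((j : ℕ) : ℤ) := fun i j hij => by simpa using hij
    refine congrFun (StrictMono.eq_of_forall_exists_eq hid hmono fun i => ?_).symm
    by_contra! hne
    -- An unused edge of the last slice would carry an axis rhombus sticking out of the hexagon. So
    -- all `a` edges there are used, which fixes the end positions.
    have hmem := (hax (i : ℕ) (by omega) (by omega) (by push_cast; omega) (by push_cast; omega)).2
      fun j hj => hne j hj.symm
    have := (axisRhombus_mem ..).1 (((mem_tilings_iff ..).1 hT).1 hmem)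
    push_cast at this
    omega
  step t _ j := by
    simp only [positionsOf]
    split_ifs <;> simp
  mono t ht := (positionsOf_spec hT ht).1

/-- The paths determine the tiling: the rhombus over each upper triangle can be read off from
whether a path uses its edge and how that path moves. -/
theorem tilingOf_eq (hT : T ∈ tilings a b c) {s : ℕ → Fin a → ℤ}
    (hs : ∀ t ≤ b + c, s t = positionsOf a b T t) : tilingOf a b c s = T := by
  have hT' := (mem_tilings_iff ..).1 hT
  have key : ∀ (t : ℕ) (x : ℤ), t < b + c → 0 ≤ x → x < a + b → 0 ≤ x + t - b →
      x + t - b < a + c →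
      ((∃ j, s t j = x ∧ s (t + 1) j = x - 1) ↔ horizontalRhombus x (x + t - b) ∈ T) ∧
      ((∃ j, s t j = x ∧ s (t + 1) j = x) ↔ verticalRhombus x (x + t - b) ∈ T) := by
    intro t x ht h1 h2 h3 h4
    have hax := (positionsOf_spec hT ht.le).2.2 x h1 h2 h3 h4
    have hex := hT'.2.1 x (x + t - b) ((mem_hexagonTriangles_true ..).2 (by omega))
    rw [hs t ht.le, hs (t + 1) ht]
    have hst : ∀ j, positionsOf a b T t j = x → positionsOf a b T (t + 1) j =
        x - if horizontalRhombus x (x + t - b) ∈ T then 1 else 0 := by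
      classical
      rintro j rfl
      rw [positionsOf]
    by_cases hx : ∃ j, positionsOf a b T t j = x
    · have hna : axisRhombus x (x + t - b) ∉ T := by
        rw [hax]; push Not; exact hx
      obtain ⟨j, hj⟩ := hx
      rcases hex with h | h | h
      · exact absurd h.1 hna
      · simp only [h.2.1, if_true] at hst
        refine ⟨iff_of_true ⟨j, hj, hst j hj⟩ h.2.1, iff_of_false ?_ h.2.2⟩
        rintro ⟨i, hi, hi'⟩
        have := hst i hi
        omega
      · simp only [h.2.1, if_false] at hst
        refine ⟨iff_of_false ?_ h.2.1, iff_of_true ⟨j, hj, by have := hst j hj; omega⟩ h.2.2⟩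
        rintro ⟨i, hi, hi'⟩
        have := hst i hi
        omega
    · have ha : axisRhombus x (x + t - b) ∈ T := by
        rw [hax]; push Not at hx; exact hx
      have : horizontalRhombus x (x + t - b) ∉ T ∧ verticalRhombus x (x + t - b) ∉ T := by
        rcases hex with h | h | h
        · exact h.2
        · exact absurd ha h.1
        · exact absurd ha h.1
      exact ⟨iff_of_false (fun ⟨j, hj, _⟩ => hx ⟨j, hj⟩) this.1,
        iff_of_false (fun ⟨j, hj, _⟩ => hx ⟨j, hj⟩) this.2⟩
  refine rhombiAt_eq a b c _ _ _ hT'.1 (fun x y h => ?_) (fun x y h => ?_) (fun x y h => ?_)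
  · rw [axisRhombus_mem] at h
    obtain ⟨t, rfl⟩ : ∃ t : ℕ, y = x + t - b := ⟨(y - x + b).toNat, by omega⟩
    rw [toNat_slice, hs t (by omega)]
    exact ((positionsOf_spec hT (by omega)).2.2 x (by omega) (by omega) (by omega) (by omega)).symm
  · rw [horizontalRhombus_mem] at h
    obtain ⟨t, rfl⟩ : ∃ t : ℕ, y = x + t - b := ⟨(y - x + b).toNat, by omega⟩
    rw [toNat_slice]
    exact (key t x (by omega) (by omega) (by omega) (by omega) (by omega)).1
  · rw [verticalRhombus_mem] at h
    obtain ⟨t, rfl⟩ : ∃ t : ℕ, y = x + t - b := ⟨(y - x + b).toNat, by omega⟩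
    rw [toNat_slice]
    exact (key t x (by omega) (by omega) (by omega) (by omega) (by omega)).2

end positionsOf

theorem isPaths_positions_iff (a b c : ℕ) (ε : Fin (b + c) → Fin a → Bool) :
    IsPaths a b c (positions (fun i : Fin a => (b : ℤ) + (i : ℕ)) ε) ↔
      IsFamily (fun _ _ => true) (fun j : Fin a => ((j : ℕ) : ℤ)) (b + c) 0
        (fun i : Fin a => (b : ℤ) + (i : ℕ)) ε := by
  refine ⟨fun h => ⟨h.mono, funext h.last, fun _ _ _ => rfl⟩, fun h => ⟨fun j => ?_, ?_, ?_, h.1⟩⟩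
  · rw [positions_zero]
  · exact congrFun h.2.1
  · intro t ht j
    rw [positions_succ _ ε ⟨t, ht⟩]
    split_ifs <;> simp

open Classical in
/-- The tilings whose horizontal rhombi are all allowed are equinumerous with the families of
nonintersecting lattice paths using allowed steps. -/
theorem card_tilings_filter (a b c : ℕ) (ok : ℕ → ℤ → Bool) :
    ((tilings a b c).filter fun T => ∀ x y, horizontalRhombus x y ∈ T →
      ok (y - x + b).toNat x).card =
    (Finset.univ.filter (IsFamily ok (fun j : Fin a => ((j : ℕ) : ℤ)) (b + c) 0
      (fun i : Fin a => (b : ℤ) + (i : ℕ)))).card := by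
  set s₀ : Fin a → ℤ := fun i => (b : ℤ) + (i : ℕ) with hs₀
  -- A tiling is encoded by when each of its paths moves, that is, runs through a horizontal
  -- rhombus.
  set f : Finset (Finset UnitTriangle) → Fin (b + c) → Fin a → Bool := fun T k j =>
    decide (horizontalRhombus (positionsOf a b T k j) (positionsOf a b T k j + (k : ℕ) - b) ∈ T)
    with hf
  have hpos : ∀ T, ∀ t ≤ b + c, positions s₀ (f T) t = positionsOf a b T t := by
    intro T t ht
    induction t with
    | zero => rw [positions_zero]; rfl
    | succ t ih =>
      funext j
      rw [positions_succ s₀ (f T) ⟨t, ht⟩, ih (by omega), positionsOf]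
      simp [hf]
  have hfam : ∀ ε, IsFamily ok (fun j : Fin a => ((j : ℕ) : ℤ)) (b + c) 0 s₀ ε ↔
      IsPaths a b c (positions s₀ ε) ∧
        ∀ (k : Fin (b + c)) (j : Fin a), ε k j → ok k (positions s₀ ε k j) := by
    intro ε
    rw [isPaths_positions_iff]
    simp [IsFamily, and_assoc, hs₀]
  refine Finset.card_nbij' f (fun ε => tilingOf a b c (positions s₀ ε)) ?_ ?_ ?_ ?_
  · intro T hT
    simp only [Finset.coe_filter, Set.mem_ofPred_eq, Finset.mem_univ, true_and] at hT ⊢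
    rw [hfam]
    have hP := isPaths_positionsOf hT.1
    refine ⟨⟨fun j => by rw [positions_zero], ?_, ?_, ?_⟩, ?_⟩
    · rw [hpos T _ le_rfl]; exact hP.last
    · intro t ht
      rw [hpos T t ht.le, hpos T (t + 1) ht]
      exact hP.step t ht
    · intro t ht
      rw [hpos T t ht]
      exact hP.mono t ht
    · intro k j hk
      rw [hpos T k k.2.le]
      have := hT.2 _ _ (of_decide_eq_true hk)
      rwa [toNat_slice] at this
  · intro ε hε
    simp only [Finset.coe_filter, Set.mem_ofPred_eq, Finset.mem_univ, true_and] at hε ⊢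
    rw [hfam] at hε
    refine ⟨tilingOf_mem_tilings hε.1, fun x y hxy => ?_⟩
    rw [tilingOf, horizontalRhombus_mem_rhombiAt, horizontalRhombus_mem] at hxy
    obtain ⟨hb, j, hj, hj'⟩ := hxy
    have ht : (y - x + b).toNat < b + c := by omega
    have := positions_succ s₀ ε ⟨_, ht⟩ j
    simp only [hj, hj'] at this
    have hεj : ε ⟨_, ht⟩ j := by
      by_contra hcon
      rw [if_neg hcon] at this
      omega
    have := hε.2 _ j hεj
    rwa [hj] at this
  · intro T hT
    simp only [Finset.coe_filter, Set.mem_ofPred_eq] at hT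
    exact tilingOf_eq hT.1 (hpos T)
  · intro ε hε
    simp only [Finset.coe_filter, Set.mem_ofPred_eq, Finset.mem_univ, true_and] at hε
    rw [hfam] at hε
    funext k j
    have h1 := positionsOf_tilingOf hε.1 k.2.le
    have h2 := horizontalRhombus_position_mem_tilingOf hε.1 k.2 j
    rw [positions_succ s₀ ε k j] at h2
    simp only [hf, h1, h2]
    cases ε k j
    · simp only [Bool.false_eq_true, if_false, decide_eq_false_iff_not]
      omega
    · simp

/-! ### Tilings with a prescribed horizontal rhombus. -/

/-- The numbers of paths from the starting points to the right edge of the horizontal rhombus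
with lowest vertex `(x, y)`. -/
noncomputable def startVector (a b : ℕ) (x y : ℤ) : Fin a → ℚ :=
  fun i => (binom ((b : ℤ) + y - x) ((b : ℤ) - x + (i : ℕ)) : ℚ)

/-- The numbers of paths from the left edge of the horizontal rhombus with lowest vertex `(x, y)`
to the end points. -/
noncomputable def endVector (a c : ℕ) (x y : ℤ) : Fin a → ℚ :=
  fun j => (binom ((c : ℤ) + x - y - 1) (x - 1 - (j : ℕ)) : ℚ)

theorem strictMono_natCast_add (a : ℕ) (z : ℤ) :
    StrictMono fun i : Fin a => z + ((i : ℕ) : ℤ) := fun i j hij => by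
  have : (i : ℕ) < j := hij
  simp only
  omega

theorem strictMono_natCast_fin (a : ℕ) : StrictMono fun i : Fin a => ((i : ℕ) : ℤ) :=
  fun i j hij => by simpa using hij

theorem card_tilings (a b c : ℕ) : ((tilings a b c).card : ℚ) = (pathMatrix a b c).det := by
  classical
  have h := card_tilings_filter a b c fun _ _ => true
  rw [Finset.filter_true_of_mem (fun _ _ _ _ _ => rfl)] at h
  rw [h, card_isFamily_eq_det _ (strictMono_natCast_fin a) _ _ (strictMono_natCast_add a b)]
  congr 1
  ext i j
  rw [of_apply, pathMatrix, of_apply, pathCount_of_forall_ok _ _ fun _ _ _ _ => rfl, Nat.cast_add]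

/-- Avoiding the rhombus forbids the single step from `x` at time `y - x + b`; the hypotheses say
that this is one of the `b + c` times. -/
theorem card_tilings_not_mem (a b c : ℕ) {x y : ℤ} (h₁ : 0 ≤ b + y - x) (h₂ : y - x < c) :
    (((tilings a b c).filter fun T => horizontalRhombus x y ∉ T).card : ℚ) =
      (pathMatrix a b c - vecMulVec (startVector a b x y) (endVector a c x y)).det := by
  classical
  have h := card_tilings_filter a b c
    fun k z => !(k == (y - x + b).toNat && z == x)
  have hfilter : ((tilings a b c).filter fun T => ∀ x' y', horizontalRhombus x' y' ∈ T →
      (!((y' - x' + b).toNat == (y - x + b).toNat && x' == x)) = true) =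
      (tilings a b c).filter fun T => horizontalRhombus x y ∉ T := by
    refine Finset.filter_congr fun T hT => ⟨fun h hxy => ?_, fun h x' y' hxy => ?_⟩
    · simpa using h x y hxy
    -- Inside the hexagon `y' - x' + b ≥ 0`, so `toNat` truncates nothing and the slice and `x`
    -- determine `y`.
    · have := (horizontalRhombus_mem ..).1 (((mem_tilings_iff ..).1 hT).1 hxy)
      by_contra hcon
      simp only [Bool.not_eq_true, Bool.not_eq_false', Bool.and_eq_true, beq_iff_eq] at hcon
      obtain ⟨e1, rfl⟩ := hcon
      obtain rfl : y' = y := by omega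
      exact h hxy
  rw [hfilter] at h
  rw [h, card_isFamily_eq_det _ (strictMono_natCast_fin a) _ _ (strictMono_natCast_add a b)]
  congr 1
  ext i j
  rw [of_apply, pathCount_forbid _ _ _ _ (Nat.zero_le _) (by omega), Matrix.sub_apply, pathMatrix,
    of_apply, vecMulVec_apply, startVector, endVector, Int.toNat_of_nonneg (by omega),
    Nat.cast_add b c, show y - x + b - ((0 : ℕ) : ℤ) = b + y - x by push_cast; ring,
    show (b : ℤ) + (i : ℕ) - x = b - x + (i : ℕ) by ring,
    show ((0 : ℕ) : ℤ) + (b + c) - 1 - (y - x + b) = c + x - y - 1 by push_cast; ring]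

/-- Complementary counting and the matrix determinant lemma `det (M - u vᵀ) = det M * (1 - v ⬝ᵥ M⁻¹
u)`. -/
theorem numTilingsContaining_eq (a b c : ℕ) {x y : ℤ} (h₁ : 0 ≤ b + y - x) (h₂ : y - x < c) :
    (numTilingsContaining a b c x y : ℚ) = (pathMatrix a b c).det *
      (endVector a c x y ⬝ᵥ ((pathMatrix a b c)⁻¹ *ᵥ startVector a b x y)) := by
  classical
  have h := Finset.card_filter_add_card_filter_not (s := tilings a b c)
    (fun T => horizontalRhombus x y ∈ T)
  have h' := congrArg (Nat.cast : ℕ → ℚ) h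
  rw [Nat.cast_add, card_tilings_not_mem a b c h₁ h₂, card_tilings] at h'
  rw [numTilingsContaining, eq_sub_of_add_eq h', sub_eq_add_neg (pathMatrix a b c),
    ← neg_vecMulVec, vecMulVec_eq Unit, det_add_replicateCol_mul_replicateRow
      (isUnit_det_pathMatrix a b c), det_unique (n := Unit), Matrix.add_apply, one_apply_eq, Matrix.mul_assoc,
    ← replicateCol_mulVec, replicateRow_mul_replicateCol_apply, mulVec_neg, dotProduct_neg]
  ring

/-! ### Slices outside the hexagon. -/

theorem numTilingsContaining_eq_zero (a b c : ℕ) {x y : ℤ} (h : b + y - x < 0 ∨ c ≤ y - x) :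
    numTilingsContaining a b c x y = 0 := by
  rw [numTilingsContaining, Finset.card_eq_zero, Finset.filter_false_of_mem]
  intro T hT hxy
  have := (horizontalRhombus_mem ..).1 (((mem_tilings_iff ..).1 hT).1 hxy)
  omega

/-- Here `v` has a negative upper argument and counts nothing. But Vandermonde solves `M w = u` with
`w j = binom n (j - x)`, `n = y - c - x`; then `w` lives on `j ≥ x` and `v` on `j < x`. The bound on
`y` gives `x + n < a`, so `w` fits. -/
theorem dotProduct_eq_zero_of_le_sub {a b c : ℕ} {x y : ℤ} (hx : 0 ≤ x) (hy : y ≤ c + a - 1)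
    (h : c ≤ y - x) :
    endVector a c x y ⬝ᵥ ((pathMatrix a b c)⁻¹ *ᵥ startVector a b x y) = 0 := by
  lift x to ℕ using hx
  obtain ⟨n, rfl⟩ : ∃ n : ℕ, y = c + x + n := ⟨(y - c - x).toNat, by omega⟩
  set w : Fin a → ℚ := fun j => (binom n ((j : ℕ) - x : ℤ) : ℚ) with hw
  have hMw : pathMatrix a b c *ᵥ w = startVector a b x (c + x + n) := by
    funext i
    have h1 := sum_range_binom_mul_binom_sub (a := a) (n := n) (x₀ := x) (by omega)
      ((b : ℤ) + c) ((b : ℤ) + (i : ℕ))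
    rw [Finset.sum_range] at h1
    rw [startVector, show (b : ℤ) + (c + x + n) - x = b + c + n by ring, sub_add_eq_add_sub, ← h1,
      mulVec, dotProduct]
    push_cast
    refine Finset.sum_congr rfl fun j _ => ?_
    rw [pathMatrix, of_apply, hw, mul_comm]
  rw [← hMw, mulVec_mulVec, nonsing_inv_mul _ (isUnit_det_pathMatrix a b c), one_mulVec]
  refine Finset.sum_eq_zero fun j _ => ?_
  rw [endVector, hw]
  rcases lt_or_ge ((j : ℕ) : ℤ) x with hj | hj
  · simp only
    rw [binom_of_neg n (by omega), Int.cast_zero, mul_zero]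
  · rw [binom_of_neg _ (by omega), Int.cast_zero, zero_mul]

/-- The mirror case: now `w M = v` is solved by `w i = binom n (i - y)`, which vanishes for `i > y +
n`, while `u` vanishes for `i ≤ y + n`. -/
theorem dotProduct_eq_zero_of_sub_lt {a b c : ℕ} {x y : ℤ} (hy : 0 ≤ y) (hx : x ≤ b + a - 1)
    (h : b + y - x < 0) :
    endVector a c x y ⬝ᵥ ((pathMatrix a b c)⁻¹ *ᵥ startVector a b x y) = 0 := by
  lift y to ℕ using hy
  obtain ⟨n, rfl⟩ : ∃ n : ℕ, x = b + y + 1 + n := ⟨(x - b - y - 1).toNat, by omega⟩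
  set w : Fin a → ℚ := fun i => (binom n ((i : ℕ) - y : ℤ) : ℚ) with hw
  have hwM : w ᵥ* pathMatrix a b c = endVector a c (b + y + 1 + n) y := by
    funext j
    have h1 := sum_range_binom_mul_binom_add (a := a) (n := n) (x₀ := y) (by omega)
      ((b : ℤ) + c) ((b : ℤ) - (j : ℕ))
    rw [Finset.sum_range] at h1
    rw [endVector, show (c : ℤ) + (b + y + 1 + n) - y - 1 = b + c + n by ring,
      show (b : ℤ) + y + 1 + n - 1 - (j : ℕ) = b - (j : ℕ) + y + n by ring, ← h1,
      vecMul, dotProduct]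
    push_cast
    refine Finset.sum_congr rfl fun i _ => ?_
    rw [pathMatrix, of_apply, hw, sub_add_eq_add_sub]
  rw [← hwM, ← dotProduct_mulVec, mulVec_mulVec, mul_nonsing_inv _ (isUnit_det_pathMatrix a b c),
    one_mulVec]
  refine Finset.sum_eq_zero fun i _ => ?_
  rw [startVector, hw]
  rcases lt_or_ge ((i : ℕ) : ℤ) (y + n + 1) with hi | hi
  · rw [binom_of_neg _ (by omega), Int.cast_zero, mul_zero]
  · simp only
    rw [binom_of_lt (by omega), Int.cast_zero, zero_mul]

/-! ### Evaluation of the triple sum. -/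

theorem pascalMatrix_mulVec_startVector (a b : ℕ) (x y : ℤ) (s : Fin a) :
    (pascalMatrix a *ᵥ startVector a b x y) s =
      (binom ((b : ℤ) - x + y + (s : ℕ)) ((b : ℤ) - x + (s : ℕ)) : ℚ) := by
  have h := sum_range_binom_mul_binom_add (a := a) (n := s) (x₀ := 0) (by omega)
    ((b : ℤ) + y - x) ((b : ℤ) - x)
  rw [Finset.sum_range] at h
  simp only [Nat.cast_zero, sub_zero, add_zero] at h
  rw [sub_add_eq_add_sub, ← h, mulVec, dotProduct]
  push_cast
  rfl

theorem pascalMatrix_mulVec_endVector (a c : ℕ) (x y : ℤ) (n : Fin a) :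
    (pascalMatrix a *ᵥ endVector a c x y) n =
      (binom ((c : ℤ) + x - y - 1 + (n : ℕ)) (x - 1) : ℚ) := by
  have h := sum_range_binom_mul_binom_sub (a := a) (n := n) (x₀ := 0) (by omega)
    ((c : ℤ) + x - y - 1) (x - 1)
  rw [Finset.sum_range] at h
  simp only [Nat.cast_zero, sub_zero] at h
  rw [← h, mulVec, dotProduct]
  push_cast
  rfl

theorem sum_Icc_one_eq_sum_fin (a : ℕ) (f : ℕ → ℚ) :
    ∑ i ∈ Finset.Icc 1 a, f i = ∑ i : Fin a, f (i + 1) := by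
  rw [← Finset.sum_range fun i => f (i + 1), Finset.range_eq_Ico, Finset.sum_Ico_add' f 0 a 1]
  rfl

theorem sum_eq_dotProduct (a b c : ℕ) (x y : ℤ) :
    ∑ n ∈ Finset.Icc 1 a, ∑ m ∈ Finset.Icc 1 a, ∑ s ∈ Finset.Icc 1 m,
      (-1 : ℚ) ^ (n + s) *
        (binom ((c : ℤ) + x - y + n - 2) (x - 1) : ℚ) *
        (binom ((b : ℤ) - x + y + s - 1) ((b : ℤ) - x + s - 1) : ℚ) *
        (poch ((b : ℚ) + 1) (s - 1) / poch ((b : ℚ) + c + 1) (s - 1)) *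
        ((m - 1).choose (s - 1) : ℚ) *
        (poch ((c : ℚ) + 1) (n - 1) / ((n - 1).factorial : ℚ)) *
        pochDivFactorial ((b : ℚ) + c + n) ((m : ℤ) - n) =
      (rightFactor a b c *ᵥ (pascalMatrix a *ᵥ endVector a c x y)) ⬝ᵥ
        (leftFactor a b c *ᵥ (pascalMatrix a *ᵥ startVector a b x y)) := by
  have extend : ∀ n, ∀ m ∈ Finset.Icc 1 a, ∑ s ∈ Finset.Icc 1 m,
      (-1 : ℚ) ^ (n + s) *
        (binom ((c : ℤ) + x - y + n - 2) (x - 1) : ℚ) *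
        (binom ((b : ℤ) - x + y + s - 1) ((b : ℤ) - x + s - 1) : ℚ) *
        (poch ((b : ℚ) + 1) (s - 1) / poch ((b : ℚ) + c + 1) (s - 1)) *
        ((m - 1).choose (s - 1) : ℚ) *
        (poch ((c : ℚ) + 1) (n - 1) / ((n - 1).factorial : ℚ)) *
        pochDivFactorial ((b : ℚ) + c + n) ((m : ℤ) - n) = ∑ s ∈ Finset.Icc 1 a,
      (-1 : ℚ) ^ (n + s) *
        (binom ((c : ℤ) + x - y + n - 2) (x - 1) : ℚ) *
        (binom ((b : ℤ) - x + y + s - 1) ((b : ℤ) - x + s - 1) : ℚ) *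
        (poch ((b : ℚ) + 1) (s - 1) / poch ((b : ℚ) + c + 1) (s - 1)) *
        ((m - 1).choose (s - 1) : ℚ) *
        (poch ((c : ℚ) + 1) (n - 1) / ((n - 1).factorial : ℚ)) *
        pochDivFactorial ((b : ℚ) + c + n) ((m : ℤ) - n) := by
    intro n m hm
    rw [Finset.mem_Icc] at hm
    refine Finset.sum_subset (Finset.Icc_subset_Icc_right hm.2) fun s hs hs' => ?_
    rw [Finset.mem_Icc] at hs hs'
    rw [Nat.choose_eq_zero_of_lt (show m - 1 < s - 1 by omega)]
    simp
  -- With `s` running up to `a` and `m` outermost, each `m` contributes a product of an `n`-sum and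
  -- an `s`-sum: the `m`-th entries of the two vectors.
  rw [Finset.sum_congr rfl fun n _ => Finset.sum_congr rfl (extend n), Finset.sum_comm]
  simp only [sum_Icc_one_eq_sum_fin, dotProduct]
  refine Finset.sum_congr rfl fun m _ => ?_
  rw [mulVec, mulVec, dotProduct, dotProduct, Finset.sum_mul_sum]
  refine Finset.sum_congr rfl fun n _ => Finset.sum_congr rfl fun s _ => ?_
  rw [pascalMatrix_mulVec_endVector, pascalMatrix_mulVec_startVector, rightFactor, leftFactor,
    of_apply, of_apply]
  simp only [Nat.add_sub_cancel]
  push_cast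
  rw [show (c : ℤ) + x - y + ((n : ℕ) + 1) - 2 = c + x - y - 1 + (n : ℕ) by ring,
    show (b : ℤ) - x + y + ((s : ℕ) + 1) - 1 = b - x + y + (s : ℕ) by ring,
    show (b : ℤ) - x + ((s : ℕ) + 1) - 1 = b - x + (s : ℕ) by ring,
    show ((m : ℕ) : ℤ) + 1 - ((n : ℕ) + 1) = (m : ℕ) - (n : ℕ) by ring, ← add_assoc]
  ring_nf

theorem poch_one_div_poch (b c : ℕ) :
    poch 1 c / poch ((b : ℚ) + 1) c = (b.factorial * c.factorial : ℚ) / (b + c).factorial := by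
  have h := poch_natCast_succ 0 c
  rw [Nat.cast_zero, zero_add, zero_add, Nat.factorial_zero, Nat.cast_one, div_one] at h
  rw [h, poch_natCast_succ]
  field_simp

theorem numTilingsContaining_eq_det_mul {a b c : ℕ} {x y : ℤ} (hx₀ : 0 ≤ x)
    (hx₁ : x ≤ b + a - 1) (hy₀ : 0 ≤ y) (hy₁ : y ≤ c + a - 1) :
    (numTilingsContaining a b c x y : ℚ) = (pathMatrix a b c).det *
      (endVector a c x y ⬝ᵥ ((pathMatrix a b c)⁻¹ *ᵥ startVector a b x y)) := by
  rcases lt_or_ge ((b : ℤ) + y - x) 0 with h₁ | h₁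
  · rw [numTilingsContaining_eq_zero a b c (Or.inl h₁),
      dotProduct_eq_zero_of_sub_lt hy₀ hx₁ h₁, mul_zero, Nat.cast_zero]
  rcases lt_or_ge (y - x) (c : ℤ) with h₂ | h₂
  · exact numTilingsContaining_eq a b c h₁ h₂
  · rw [numTilingsContaining_eq_zero a b c (Or.inr h₂),
      dotProduct_eq_zero_of_le_sub hx₀ hy₁ h₂, mul_zero, Nat.cast_zero]

end RhombusTiling

theorem mainTheorem5 (a b c : ℕ) (ha : 0 < a) (hb : 0 < b) (hc : 0 < c)
    (x y : ℤ) (hx₀ : 0 ≤ x) (hx₁ : x ≤ (b : ℤ) + a - 1)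
    (hy₀ : 1 ≤ y) (hy₁ : y ≤ (c : ℤ) + a - 1) :
    (RhombusTiling.numTilingsContaining a b c x y : ℚ) =
      (∏ i ∈ Finset.Icc 1 a, ∏ j ∈ Finset.Icc 1 b, ∏ k ∈ Finset.Icc 1 c,
          ((i : ℚ) + (j : ℚ) + (k : ℚ) - 1) / ((i : ℚ) + (j : ℚ) + (k : ℚ) - 2)) *
        (RhombusTiling.poch 1 c / RhombusTiling.poch ((b : ℚ) + 1) c) *
        ∑ n ∈ Finset.Icc 1 a, ∑ m ∈ Finset.Icc 1 a, ∑ s ∈ Finset.Icc 1 m,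
          (-1 : ℚ) ^ (n + s) *
            (RhombusTiling.binom ((c : ℤ) + x - y + n - 2) (x - 1) : ℚ) *
            (RhombusTiling.binom ((b : ℤ) - x + y + s - 1) ((b : ℤ) - x + s - 1) : ℚ) *
            (RhombusTiling.poch ((b : ℚ) + 1) (s - 1) /
              RhombusTiling.poch ((b : ℚ) + c + 1) (s - 1)) *
            ((m - 1).choose (s - 1) : ℚ) *
            (RhombusTiling.poch ((c : ℚ) + 1) (n - 1) / ((n - 1).factorial : ℚ)) *
            RhombusTiling.pochDivFactorial ((b : ℚ) + c + n) ((m : ℤ) - n) := by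
  rw [RhombusTiling.sum_eq_dotProduct, RhombusTiling.poch_one_div_poch,
    RhombusTiling.prod_box_eq_det_pathMatrix, mul_assoc,
    ← RhombusTiling.dotProduct_inv_pathMatrix_mulVec]
  exact RhombusTiling.numTilingsContaining_eq_det_mul hx₀ hx₁ (by omega) hy₁
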